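/- Let $n\ge 0$, $d=2^n$, and let $\{L_{j}\}_{j=1}^{K}$ (signal) and $\{L_k\}_{k=K+1}^{K+N}$ (noise) be pairwise different non-identity $n$-qubit Pauli operators (tensor products of $I,\sigma_x,\sigma_y,\sigma_z$). Let the noise decay rates be $\gamma_k>0$, let $T>0$ be the total time, and let the state of the qubits obey $$\dot\rho=\theta^2\sum_{j=1}^{K}\mathcal L_j(\rho)+\sum_{k=K+1}^{K+N}\gamma_k\mathcal L_k(\rho),\qquad \mathcal L_j(\rho)=L_j\rho L_j^\dagger-\tfrac12\{L_j^\dagger L_j,\rho\},$$ where $\theta=\sqrt{\gamma_1}>0$ is to be estimated. The classical Fisher information (CFI) of outcome probabilities $p_x(\theta)$ is $\sum_{x:\,p_x(\theta)\ne0}(\partial_\theta p_x)^2/p_x$; the quantum Fisher information (QFI) of a strategy is the supremum of the CFI over the allowed measurements. In an extended strategy the operators act as $L\otimes I$ on the qubits and a noiseless finite-dimensional ancilla. An extended sequential strategy with $M$ steps starts from any joint state, alternates $M$ times the evolution for time $T/M$ with an arbitrary control channel on qubits and ancilla, and ends with any measurement (POVM); its optimal QFI is the supremum over ancillae, states, controls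 and measurements. An extended measure-and-reset strategy with state $|\psi\rangle$ consists of $M$ independent rounds: prepare $|\psi\rangle$, evolve for time $T/M$, and perform one and the same measurement. All Fisher informations are taken in the limit of fast control, $M\to\infty$ at fixed $\theta$, followed by the vanishing-signal limit $\theta\to0^+$. For every Bell state $|\psi\rangle=d^{-1/2}\sum_{j=1}^{d}|e_j\rangle\otimes|e_j\rangle$, with $\{|e_j\rangle\}$ an orthonormal basis of $(\mathbb C^2)^{\otimes n}$: 1. The optimal QFI of the extended sequential strategies in the noiseless case ($N=0$) is $4KT$, and it equals $4T\max_{|\varphi\rangle}\sum_{j=1}^{K}\bigl(\langle\varphi|L_j^\dagger L_j|\varphi\rangle-|\langle\varphi|L_j|\varphi\rangle|^2\bigr)$, the maximum being over unit vectors of the qubits with any finite-dimensional ancilla. 2. In the presence of the noise, the extended measure-and-reset strategy with the Bell state recovers this value: its QFI is $4KT$. It is already attained by the two-outcome measurement $\{\Pi,I-\Pi\}$, where $\Pi$ is the projection onto $\mathrm{span}\{|\psi\rangle,(L_k\otimes I)|\psi\rangle: K<k\le K+N\}$, and $4T\sum_{j=1}^{K}\langle\psi|(L_j\otimes I)^\dagger(I-\Pi)(L_j\otimes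 I)|\psi\rangle=4KT$. 3. The Bell state and its images $(P\otimes I)|\psi\rangle$ under the $4^n-1$ non-identity $n$-qubit Pauli operators $P$ are pairwise orthogonal unit vectors. -/

import Mathlib

open scoped ComplexOrder Matrix Kronecker ENNReal InnerProductSpace Topology
open Filter

noncomputable section

/-! ### Lindblad evolution -/

section Lindblad

variable {d : Type*} [Fintype d] [DecidableEq d]

/-- The Lindblad superoperator `ρ ↦ L ρ L† - (L†L ρ + ρ L†L)/2` of a jump operator `L`. -/
def dissipator (L : Matrix d d ℂ) : Module.End ℂ (Matrix d d ℂ) :=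
  LinearMap.mulLeft ℂ L ∘ₗ LinearMap.mulRight ℂ Lᴴ
    - (1 / 2 : ℂ) • (LinearMap.mulLeft ℂ (Lᴴ * L) + LinearMap.mulRight ℂ (Lᴴ * L))

/-- The generator of the master equation (without Hamiltonian) with signal jump operators `Ls`,
common signal decay rate `θ ^ 2`, noise jump operators `Ln` and noise decay rates `γ`. The
parameter to be estimated is `θ`, the square root of the signal decay rate. -/
def generator {ι κ : Type*} [Fintype ι] [Fintype κ] (Ls : ι → Matrix d d ℂ)
    (Ln : κ → Matrix d d ℂ) (γ : κ → ℝ) (θ : ℝ) : Module.End ℂ (Matrix d d ℂ) :=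
  ((θ ^ 2 : ℝ) : ℂ) • ∑ j, dissipator (Ls j) + ∑ k, ((γ k : ℝ) : ℂ) • dissipator (Ln k)

/-- The solution `exp (t 𝓛) ρ` at time `t` of `dρ/dt = 𝓛 ρ` with initial value `ρ`. -/
def evolve (𝓛 : Module.End ℂ (Matrix d d ℂ)) (t : ℝ) (ρ : Matrix d d ℂ) : Matrix d d ℂ :=
  ∑' k : ℕ, ((t ^ k / (k.factorial : ℝ) : ℝ) : ℂ) • (𝓛 ^ k) ρ

/-- The operator `L ⊗ I` on the system with a noiseless ancilla with index type `α`. -/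
def withAncilla (α : Type*) [DecidableEq α] (L : Matrix d d ℂ) : Matrix (d × α) (d × α) ℂ :=
  L ⊗ₖ (1 : Matrix α α ℂ)

/-- The evolution for time `t` of the system and a noiseless ancilla, when the jump operators act
on the system only. -/
def extendedEvolution (α : Type*) [Fintype α] [DecidableEq α] {ι κ : Type*} [Fintype ι] [Fintype κ]
    (Ls : ι → Matrix d d ℂ) (Ln : κ → Matrix d d ℂ) (γ : κ → ℝ) (θ t : ℝ)
    (ρ : Matrix (d × α) (d × α) ℂ) : Matrix (d × α) (d × α) ℂ :=
  evolve (generator (fun j => withAncilla α (Ls j)) (fun k => withAncilla α (Ln k)) γ θ) t ρ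

end Lindblad

/-! ### States, measurements, channels and Fisher information -/

section Quantum

variable {e : Type*} [Fintype e] [DecidableEq e]

/-- Density matrices. -/
def IsDensityMatrix (ρ : Matrix e e ℂ) : Prop :=
  ρ.PosSemidef ∧ ρ.trace = 1

/-- Positive operator-valued measures with finitely many outcomes. -/
def IsPOVM {X : Type*} [Fintype X] (E : X → Matrix e e ℂ) : Prop :=
  (∀ x, (E x).PosSemidef) ∧ ∑ x, E x = 1

/-- Quantum channels, through a Kraus representation. -/
def IsChannel (C : Matrix e e ℂ → Matrix e e ℂ) : Prop :=
  ∃ (r : ℕ) (A : Fin r → Matrix e e ℂ), ∑ j, (A j)ᴴ * A j = 1 ∧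
    ∀ ρ, C ρ = ∑ j, A j * ρ * (A j)ᴴ

/-- The probability of the outcome with effect `E` in the state `ρ`. -/
def outcomeProb (ρ E : Matrix e e ℂ) : ℝ :=
  (ρ * E).trace.re

/-- The rank-one operator `|ψ⟩⟨ψ|`. -/
def pureState (ψ : EuclideanSpace ℂ e) : Matrix e e ℂ :=
  Matrix.of fun x y => ψ x * star (ψ y)

/-- The vector `A|ψ⟩`. -/
def applyOp (A : Matrix e e ℂ) (ψ : EuclideanSpace ℂ e) : EuclideanSpace ℂ e :=
  Matrix.toEuclideanLin A ψ

/-- The variance `⟨ψ|A†A|ψ⟩ - |⟨ψ|A|ψ⟩|²`. -/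
def variance (ψ : EuclideanSpace ℂ e) (A : Matrix e e ℂ) : ℝ :=
  ‖applyOp A ψ‖ ^ 2 - ‖⟪ψ, applyOp A ψ⟫_ℂ‖ ^ 2

/-- The classical Fisher information at `θ` of a parametrised probability vector `p`. Outcomes of
probability zero do not contribute (division by zero gives zero). -/
def fisherInfo {X : Type*} [Fintype X] (p : ℝ → X → ℝ) (θ : ℝ) : ℝ :=
  ∑ x, (deriv (fun s => p s x) θ) ^ 2 / p θ x

/-- The law of `M` independent repetitions of an experiment with law `p`. -/
def iidLaw {X : Type*} (p : X → ℝ) (M : ℕ) : (Fin M → X) → ℝ :=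
  fun x => ∏ i, p (x i)

/-- The projection onto the noisy subspace, spanned by `ψ` and the images of `ψ` under the noise
operators. -/
def noisyProjection {κ : Type*} (Ln : κ → Matrix e e ℂ) (ψ : EuclideanSpace ℂ e) :
    Matrix e e ℂ :=
  (Matrix.toEuclideanCLM (n := e) (𝕜 := ℂ)).symm
    (Submodule.span ℂ (insert ψ (Set.range fun k => applyOp (Ln k) ψ))).starProjection

/-- The two-outcome measurement that asks whether the state lies in the noisy subspace. -/
def noisyMeasurement {κ : Type*} (Ln : κ → Matrix e e ℂ) (ψ : EuclideanSpace ℂ e) :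
    Bool → Matrix e e ℂ
  | true => noisyProjection Ln ψ
  | false => 1 - noisyProjection Ln ψ

/-- The state after `M` rounds, each made of one use of `Φ` and then a control operation. -/
def sequentialState (Φ : Matrix e e ℂ → Matrix e e ℂ) (C : ℕ → Matrix e e ℂ → Matrix e e ℂ)
    (ρ : Matrix e e ℂ) : ℕ → Matrix e e ℂ
  | 0 => ρ
  | M + 1 => C M (Φ (sequentialState Φ C ρ M))

end Quantum

/-! ### Metrological strategies of total time `T` -/

section Strategies

variable {d : Type*} [Fintype d] [DecidableEq d] {ι κ : Type*} [Fintype ι] [Fintype κ]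

/-- The Fisher information about `θ` of the extended measure-and-reset strategy which in each of
`M` rounds prepares `ψ`, lets it evolve for time `T / M`, and measures `E`. -/
def measureResetFisherInfo {α : Type*} [Fintype α] [DecidableEq α] (Ls : ι → Matrix d d ℂ)
    (Ln : κ → Matrix d d ℂ) (γ : κ → ℝ) (T : ℝ) (ψ : EuclideanSpace ℂ (d × α))
    {X : Type*} [Fintype X] (E : X → Matrix (d × α) (d × α) ℂ) (θ : ℝ) (M : ℕ) : ℝ≥0∞ :=
  ENNReal.ofReal (fisherInfo (fun s => iidLaw (fun x =>
    outcomeProb (extendedEvolution α Ls Ln γ s (T / M) (pureState ψ)) (E x)) M) θ)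

/-- The quantum Fisher information of the extended measure-and-reset strategy with state `ψ`: the
best Fisher information over all measurements used in the rounds. -/
def measureResetQFI {α : Type*} [Fintype α] [DecidableEq α] (Ls : ι → Matrix d d ℂ)
    (Ln : κ → Matrix d d ℂ) (γ : κ → ℝ) (T : ℝ) (ψ : EuclideanSpace ℂ (d × α))
    (θ : ℝ) (M : ℕ) : ℝ≥0∞ :=
  ⨆ (m : ℕ) (E : Fin m → Matrix (d × α) (d × α) ℂ) (_ : IsPOVM E),
    measureResetFisherInfo Ls Ln γ T ψ E θ M

/-- The optimal quantum Fisher information about `θ` of the extended sequential strategies with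
`M` control operations: the supremum over all finite-dimensional noiseless ancillae, all initial
states, all control channels applied after each evolution for time `T / M`, and all final
measurements. -/
def sequentialQFI (Ls : ι → Matrix d d ℂ) (Ln : κ → Matrix d d ℂ) (γ : κ → ℝ) (T : ℝ)
    (θ : ℝ) (M : ℕ) : ℝ≥0∞ :=
  ⨆ (α : Type) (_ : Fintype α) (_ : DecidableEq α)
    (ρ : Matrix (d × α) (d × α) ℂ) (_ : IsDensityMatrix ρ)
    (C : ℕ → Matrix (d × α) (d × α) ℂ → Matrix (d × α) (d × α) ℂ) (_ : ∀ i, IsChannel (C i))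
    (m : ℕ) (E : Fin m → Matrix (d × α) (d × α) ℂ) (_ : IsPOVM E),
    ENNReal.ofReal (fisherInfo (fun s x =>
      outcomeProb (sequentialState (extendedEvolution α Ls Ln γ s (T / M)) C ρ M) (E x)) θ)

/-- `F θ M` has the limit `v` when first the round length `T / M` tends to zero, i.e. `M → ∞`
(fast control), and then the signal `θ` tends to zero. -/
def HasFastControlVanishingSignalLimit (F : ℝ → ℕ → ℝ≥0∞) (v : ℝ) : Prop :=
  ∃ g : ℝ → ℝ≥0∞, (∀ᶠ θ in 𝓝[>] 0, Tendsto (F θ) atTop (𝓝 (g θ))) ∧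
    Tendsto g (𝓝[>] 0) (𝓝 (ENNReal.ofReal v))

end Strategies

/-! ### Pauli operators and Bell states -/

/-- The one-qubit operators `I, σx, σy, σz`. -/
def pauli : Fin 4 → Matrix (Fin 2) (Fin 2) ℂ :=
  ![1, !![0, 1; 1, 0], !![0, -Complex.I; Complex.I, 0], !![1, 0; 0, -1]]

/-- The tensor product of the `n` one-qubit Pauli operators listed by `P`, in the computational
basis `Fin n → Fin 2`. The zero label is the identity operator. -/
def pauliString {n : ℕ} (P : Fin n → Fin 4) : Matrix (Fin n → Fin 2) (Fin n → Fin 2) ℂ :=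
  Matrix.of fun x y => ∏ i, pauli (P i) (x i) (y i)

/-- The Bell state `d^(-1/2) ∑ j, |e_j⟩ ⊗ |e_j⟩` of an orthonormal basis `b`. -/
def bellState {d : Type*} [Fintype d] (b : OrthonormalBasis d ℂ (EuclideanSpace ℂ d)) :
    EuclideanSpace ℂ (d × d) :=
  WithLp.toLp 2 fun x => (1 / (Real.sqrt (Fintype.card d) : ℂ)) * ∑ j, b j x.1 * b j x.2

end

/-!
Pauli operators are involutions that commute up to a sign, and the sign cancels in `L ρ L†`, so all
the jumps commute. Evolving for a time `t` therefore amounts to applying a noise channel that does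
not depend on `θ` and then, for each signal operator, flipping the state by that operator with
probability `(1 - exp (-2 θ² t)) / 2`. The final state of an `M`-step adaptive strategy is thus
obtained from `K M` independent coins by a procedure that does not involve `θ`. Each coin has Fisher
information at most `4 T / M`, so additivity and data processing bound the information of every
strategy by `4 K T`, whatever the ancilla, the controls and the measurement are.

Conversely, Pauli errors on one half of a Bell state lead to pairwise orthogonal states. The
projection off the noisy subspace then sees no noise to first order in time: it clicks with
probability `p ≈ K θ² t`, for which `(∂p)² / p ≈ 4 K t`, and `M` rounds of length `t = T / M` attain
`4 K T`. Measure-and-reset is itself a sequential strategy, the outcomes being recorded in the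
ancilla, so the optimal sequential strategies have the same limit.
-/

/-! ### Classical Fisher information -/

section FisherInformation

variable {X Y : Type*} [Fintype X] [Fintype Y]

/-- A parametrised probability vector whose entries are differentiable at `θ`: the regularity under
which `fisherInfo p θ` has its statistical meaning. The law is required to be a probability vector
at every parameter, so that an entry which vanishes at `θ` has derivative zero there. -/
structure IsDifferentiableLaw (p : ℝ → X → ℝ) (θ : ℝ) : Prop where
  nonneg : ∀ s x, 0 ≤ p s x
  sum_eq_one : ∀ s, ∑ x, p s x = 1
  differentiableAt : ∀ x, DifferentiableAt ℝ (fun s => p s x) θ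

namespace IsDifferentiableLaw

variable {p : ℝ → X → ℝ} {q : ℝ → Y → ℝ} {θ : ℝ}

theorem deriv_eq_zero (hp : IsDifferentiableLaw p θ) {x : X} (hx : p θ x = 0) :
    deriv (fun s => p s x) θ = 0 :=
  IsLocalMin.deriv_eq_zero <| Eventually.of_forall fun s => by simpa [hx] using hp.nonneg s x

theorem sum_deriv (hp : IsDifferentiableLaw p θ) : ∑ x, deriv (fun s => p s x) θ = 0 := by
  rw [← deriv_fun_sum fun x _ => hp.differentiableAt x]
  simp [hp.sum_eq_one]

theorem iid (hp : IsDifferentiableLaw p θ) (M : ℕ) :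
    IsDifferentiableLaw (fun s => iidLaw (p s) M) θ where
  nonneg s x := Finset.prod_nonneg fun i _ => hp.nonneg s (x i)
  sum_eq_one s := by simp only [iidLaw, ← Fintype.sum_pow, hp.sum_eq_one, one_pow]
  differentiableAt x := DifferentiableAt.fun_finsetProd fun i _ => hp.differentiableAt (x i)

theorem postprocess (hq : IsDifferentiableLaw q θ) {b : Y → X → ℝ} (hb : ∀ y x, 0 ≤ b y x)
    (hb1 : ∀ y, ∑ x, b y x = 1) : IsDifferentiableLaw (fun s x => ∑ y, q s y * b y x) θ where
  nonneg s x := Finset.sum_nonneg fun y _ => mul_nonneg (hq.nonneg s y) (hb y x)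
  sum_eq_one s := by
    rw [Finset.sum_comm]
    simp only [← Finset.mul_sum, hb1, mul_one, hq.sum_eq_one]
  differentiableAt x := DifferentiableAt.fun_sum fun y _ => (hq.differentiableAt y).mul_const _

end IsDifferentiableLaw

variable {p : ℝ → X → ℝ} {q : ℝ → Y → ℝ} {θ : ℝ}

theorem fisherInfo_comp_equiv (p : ℝ → X → ℝ) (e : Y ≃ X) (θ : ℝ) :
    fisherInfo (fun s y => p s (e y)) θ = fisherInfo p θ :=
  e.sum_comp fun x => (deriv (fun s => p s x) θ) ^ 2 / p θ x

theorem fisherInfo_prod (hp : IsDifferentiableLaw p θ) (hq : IsDifferentiableLaw q θ) :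
    fisherInfo (fun s (z : X × Y) => p s z.1 * q s z.2) θ = fisherInfo p θ + fisherInfo q θ := by
  have score_sq : ∀ x y, (deriv (fun s => p s x * q s y) θ) ^ 2 / (p θ x * q θ y) =
      (deriv (fun s => p s x) θ) ^ 2 / p θ x * q θ y
      + 2 * (deriv (fun s => p s x) θ * deriv (fun s => q s y) θ)
      + p θ x * ((deriv (fun s => q s y) θ) ^ 2 / q θ y) := by
    intro x y
    rw [deriv_fun_mul (hp.differentiableAt x) (hq.differentiableAt y)]
    by_cases hx : p θ x = 0
    · simp [hx, hp.deriv_eq_zero hx]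
    by_cases hy : q θ y = 0
    · simp [hy, hq.deriv_eq_zero hy]
    field_simp
    ring
  unfold fisherInfo
  rw [Fintype.sum_prod_type]
  simp only [score_sq, Finset.sum_add_distrib, ← Finset.mul_sum, ← Finset.sum_mul,
    hp.sum_eq_one, hq.sum_eq_one, hp.sum_deriv, hq.sum_deriv]
  ring

theorem iidLaw_cons {Z : Type*} (p : Z → ℝ) (M : ℕ) (z : Z × (Fin M → Z)) :
    iidLaw p (M + 1) (Fin.consEquiv (fun _ => Z) z) = p z.1 * iidLaw p M z.2 := by
  simp [iidLaw, Fin.prod_univ_succ]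

theorem fisherInfo_iid (hp : IsDifferentiableLaw p θ) (M : ℕ) :
    fisherInfo (fun s => iidLaw (p s) M) θ = M * fisherInfo p θ := by
  induction M with
  | zero => simp [iidLaw, fisherInfo]
  | succ M ih =>
    rw [← fisherInfo_comp_equiv _ (Fin.consEquiv fun _ => X)]
    simp only [iidLaw_cons]
    rw [fisherInfo_prod hp (hp.iid M), ih]
    push_cast
    ring

theorem fisherInfo_postprocess_le (hq : IsDifferentiableLaw q θ) {b : Y → X → ℝ}
    (hb : ∀ y x, 0 ≤ b y x) (hb1 : ∀ y, ∑ x, b y x = 1) :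
    fisherInfo (fun s x => ∑ y, q s y * b y x) θ ≤ fisherInfo q θ := by
  have outcome_le : ∀ x, (deriv (fun s => ∑ y, q s y * b y x) θ) ^ 2 / ∑ y, q θ y * b y x ≤
      ∑ y, (deriv (fun s => q s y) θ) ^ 2 / q θ y * b y x := by
    intro x
    rw [deriv_fun_sum fun y _ => (hq.differentiableAt y).mul_const _]
    simp only [deriv_mul_const (hq.differentiableAt _)]
    have info_nonneg : ∀ y, 0 ≤ (deriv (fun s => q s y) θ) ^ 2 / q θ y * b y x := fun y =>
      mul_nonneg (div_nonneg (sq_nonneg _) (hq.nonneg θ y)) (hb y x)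
    have prob_nonneg : ∀ y, 0 ≤ q θ y * b y x := fun y => mul_nonneg (hq.nonneg θ y) (hb y x)
    refine div_le_of_le_mul₀ (Finset.sum_nonneg fun y _ => prob_nonneg y)
      (Finset.sum_nonneg fun y _ => info_nonneg y) ?_
    refine Finset.sum_sq_le_sum_mul_sum_of_sq_le_mul _ (fun y _ => info_nonneg y)
      (fun y _ => prob_nonneg y) fun y _ => ?_
    by_cases hy : q θ y = 0
    · simp [hq.deriv_eq_zero hy]
    · exact le_of_eq (by field_simp)
  refine (Finset.sum_le_sum fun x _ => outcome_le x).trans_eq ?_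
  rw [Finset.sum_comm]
  simp only [← Finset.mul_sum, hb1, mul_one, fisherInfo]

/-- The law of a coin which shows `true` with probability `q`. -/
def bernoulliLaw (q : ℝ) : Bool → ℝ
  | true => q
  | false => 1 - q

theorem fisherInfo_bernoulliLaw {q : ℝ → ℝ} (h0 : q θ ≠ 0) (h1 : q θ ≠ 1) :
    fisherInfo (fun s => bernoulliLaw (q s)) θ = deriv q θ ^ 2 / (q θ * (1 - q θ)) := by
  have h1' : 1 - q θ ≠ 0 := sub_ne_zero.2 h1.symm
  simp only [fisherInfo, Fintype.sum_bool, bernoulliLaw, deriv_const_sub, neg_sq]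
  field_simp
  ring

/-- The probability that a Poisson process of rate `c` jumps an odd number of times in time `t`. -/
noncomputable def flipProb (c t : ℝ) : ℝ :=
  (1 - Real.exp (-(2 * (t * c)))) / 2

theorem flipProb_nonneg {c t : ℝ} (h : 0 ≤ t * c) : 0 ≤ flipProb c t := by
  have : Real.exp (-(2 * (t * c))) ≤ 1 := Real.exp_le_one_iff.2 (by linarith)
  unfold flipProb
  linarith

theorem flipProb_lt_one (c t : ℝ) : flipProb c t < 1 := by
  have := Real.exp_pos (-(2 * (t * c)))
  unfold flipProb
  linarith

theorem flipProb_mul_one_sub (c t : ℝ) :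
    flipProb c t * (1 - flipProb c t) = (1 - Real.exp (-(2 * (t * c))) ^ 2) / 4 := by
  unfold flipProb
  ring

theorem hasDerivAt_flipProb_sq (t θ : ℝ) :
    HasDerivAt (fun s => flipProb (s ^ 2) t) (2 * t * θ * Real.exp (-(2 * (t * θ ^ 2)))) θ := by
  have h : HasDerivAt (fun s : ℝ => -(2 * (t * s ^ 2))) (-(2 * (t * (2 * θ)))) θ := by
    simpa using (((hasDerivAt_pow 2 θ).const_mul t).const_mul 2).fun_neg
  exact ((h.exp.const_sub 1).div_const 2).congr_deriv (by ring)

theorem isDifferentiableLaw_flip {t : ℝ} (ht : 0 ≤ t) (θ : ℝ) :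
    IsDifferentiableLaw (fun s => bernoulliLaw (flipProb (s ^ 2) t)) θ where
  nonneg s
    | true => flipProb_nonneg (by positivity)
    | false => sub_nonneg.2 (flipProb_lt_one _ _).le
  sum_eq_one s := by simp [bernoulliLaw]
  differentiableAt
    | true => (hasDerivAt_flipProb_sq t θ).differentiableAt
    | false => (hasDerivAt_flipProb_sq t θ).differentiableAt.const_sub 1

theorem fisherInfo_flip {t θ : ℝ} (ht : 0 < t) (hθ : θ ≠ 0) :
    fisherInfo (fun s => bernoulliLaw (flipProb (s ^ 2) t)) θ =
      4 * t * (4 * t * θ ^ 2 / (Real.exp (4 * t * θ ^ 2) - 1)) := by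
  have hexp : Real.exp (-(2 * (t * θ ^ 2))) ^ 2 = (Real.exp (4 * t * θ ^ 2))⁻¹ := by
    rw [← Real.exp_nat_mul, ← Real.exp_neg]
    ring_nf
  have hlt : 1 < Real.exp (4 * t * θ ^ 2) := Real.one_lt_exp_iff.2 (by positivity)
  have hvar : 0 < flipProb (θ ^ 2) t * (1 - flipProb (θ ^ 2) t) := by
    rw [flipProb_mul_one_sub, hexp]
    have := inv_lt_one_of_one_lt₀ hlt
    linarith
  rw [fisherInfo_bernoulliLaw (q := fun s => flipProb (s ^ 2) t) (left_ne_zero_of_mul hvar.ne')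
      (flipProb_lt_one _ _).ne, (hasDerivAt_flipProb_sq t θ).deriv, flipProb_mul_one_sub, mul_pow,
    hexp]
  have := (sub_pos.2 hlt).ne'
  field_simp
  ring

theorem fisherInfo_flip_le {t θ : ℝ} (ht : 0 ≤ t) (hθ : θ ≠ 0) :
    fisherInfo (fun s => bernoulliLaw (flipProb (s ^ 2) t)) θ ≤ 4 * t := by
  rcases ht.eq_or_lt with rfl | ht
  · simp [fisherInfo, (hasDerivAt_flipProb_sq 0 θ).deriv, bernoulliLaw]
  rw [fisherInfo_flip ht hθ]
  refine mul_le_of_le_one_right (by positivity) (div_le_one_of_le₀ ?_ ?_)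
  · linarith [Real.add_one_le_exp (4 * t * θ ^ 2)]
  · exact sub_nonneg.2 (Real.one_le_exp (by positivity))

end FisherInformation

/-! ### The evolution as an operator exponential -/

section Evolution

open scoped Matrix.Norms.Elementwise

theorem exp_add_of_commute_of_complex {R : Type*} [NormedRing R] [NormedAlgebra ℂ R]
    [CompleteSpace R] {x y : R} (h : Commute x y) :
    NormedSpace.exp (x + y) = NormedSpace.exp x * NormedSpace.exp y :=
  let _ := NormedAlgebra.restrictScalars ℚ ℂ R
  NormedSpace.exp_add_of_commute h

variable {d e : Type*}

theorem hasSum_exp_apply [Fintype d] (A : Module.End ℂ (Matrix d d ℂ)) (t : ℝ) (ρ : Matrix d d ℂ) :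
    HasSum (fun k : ℕ => ((t ^ k / (k.factorial : ℝ) : ℝ) : ℂ) • (A ^ k) ρ)
      (NormedSpace.exp ((t : ℂ) • Module.End.toContinuousLinearMap _ A) ρ) := by
  have h := NormedSpace.exp_series_hasSum_exp' (𝕂 := ℂ)
    ((t : ℂ) • Module.End.toContinuousLinearMap _ A)
  refine (h.mapL (ContinuousLinearMap.apply ℂ _ ρ)).congr_fun fun k => ?_
  rw [smul_pow, ← map_pow, smul_smul, ContinuousLinearMap.apply_apply]
  push_cast
  rw [div_eq_inv_mul]
  rfl

theorem evolve_eq_exp [Fintype d] (A : Module.End ℂ (Matrix d d ℂ)) (t : ℝ) (ρ : Matrix d d ℂ) :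
    evolve A t ρ = NormedSpace.exp ((t : ℂ) • Module.End.toContinuousLinearMap _ A) ρ :=
  (hasSum_exp_apply A t ρ).tsum_eq

variable [Finite d] {A B : Module.End ℂ (Matrix d d ℂ)}

theorem hasSum_evolve (A : Module.End ℂ (Matrix d d ℂ)) (t : ℝ) (ρ : Matrix d d ℂ) :
    HasSum (fun k : ℕ => ((t ^ k / (k.factorial : ℝ) : ℝ) : ℂ) • (A ^ k) ρ) (evolve A t ρ) := by
  cases nonempty_fintype d
  exact evolve_eq_exp A t ρ ▸ hasSum_exp_apply A t ρ

theorem isLinearMap_evolve (A : Module.End ℂ (Matrix d d ℂ)) (t : ℝ) :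
    IsLinearMap ℂ (evolve A t) where
  map_add ρ σ := by
    cases nonempty_fintype d
    simp only [evolve_eq_exp, map_add]
  map_smul c ρ := by
    cases nonempty_fintype d
    simp only [evolve_eq_exp, map_smul]

theorem evolve_map [Finite e] {B : Module.End ℂ (Matrix e e ℂ)}
    (f : Matrix d d ℂ →ₗ[ℂ] Matrix e e ℂ) (h : ∀ ρ, B (f ρ) = f (A ρ)) (t : ℝ) (ρ : Matrix d d ℂ) :
    evolve B t (f ρ) = f (evolve A t ρ) := by
  refine (hasSum_evolve B t (f ρ)).unique (((hasSum_evolve A t ρ).map f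
    (LinearMap.continuous_of_finiteDimensional f)).congr_fun fun k => ?_)
  have hpow : (B ^ k) (f ρ) = f ((A ^ k) ρ) := by
    induction k with
    | zero => rfl
    | succ k ih => rw [pow_succ', pow_succ', Module.End.mul_apply, ih, h, Module.End.mul_apply]
  simp [hpow]

theorem evolve_add_of_commute (h : Commute A B) (t : ℝ) (ρ : Matrix d d ℂ) :
    evolve (A + B) t ρ = evolve A t (evolve B t ρ) := by
  cases nonempty_fintype d
  have hcomm : Commute ((t : ℂ) • Module.End.toContinuousLinearMap _ A)
      ((t : ℂ) • Module.End.toContinuousLinearMap _ B) :=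
    ((h.map (Module.End.toContinuousLinearMap _)).smul_left _).smul_right _
  simp only [evolve_eq_exp]
  rw [map_add, smul_add, exp_add_of_commute_of_complex hcomm]
  rfl

theorem evolve_smul (A : Module.End ℂ (Matrix d d ℂ)) (c t : ℝ) (ρ : Matrix d d ℂ) :
    evolve ((c : ℂ) • A) t ρ = evolve A (t * c) ρ := by
  cases nonempty_fintype d
  rw [evolve_eq_exp, evolve_eq_exp, map_smul, smul_smul]
  push_cast
  rfl

theorem evolve_time_zero (A : Module.End ℂ (Matrix d d ℂ)) (ρ : Matrix d d ℂ) :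
    evolve A 0 ρ = ρ := by
  cases nonempty_fintype d
  simp [evolve_eq_exp]

theorem evolve_of_apply_eq_smul {c : ℝ} {ρ : Matrix d d ℂ} (h : A ρ = (c : ℂ) • ρ) (t : ℝ) :
    evolve A t ρ = ((Real.exp (t * c) : ℝ) : ℂ) • ρ := by
  have hpow : ∀ k : ℕ, (A ^ k) ρ = ((c : ℂ) ^ k) • ρ := fun k => by
    induction k with
    | zero => simp
    | succ k ih => rw [pow_succ', Module.End.mul_apply, ih, map_smul, h, smul_smul, pow_succ]
  have hexp : HasSum (fun k : ℕ => (((t * c) ^ k / (k.factorial : ℝ) : ℝ) : ℂ))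
      ((Real.exp (t * c) : ℝ) : ℂ) := by
    rw [Real.exp_eq_exp_ℝ]
    exact_mod_cast NormedSpace.expSeries_div_hasSum_exp (𝔸 := ℝ) (t * c)
  refine (hasSum_evolve A t ρ).unique ((hexp.smul_const ρ).congr_fun fun k => ?_)
  rw [hpow, smul_smul]
  push_cast
  ring_nf

theorem evolve_zero (t : ℝ) (ρ : Matrix d d ℂ) : evolve 0 t ρ = ρ := by
  simpa using evolve_of_apply_eq_smul (A := 0) (c := 0) (ρ := ρ) (by simp) t

/-- `ρ` is the sum of the eigenvectors `(ρ + J ρ) / 2` and `(ρ - J ρ) / 2` of `J - 1`, with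
eigenvalues `0` and `-2`. -/
theorem evolve_smul_involution {J : Module.End ℂ (Matrix d d ℂ)} (hJ : J * J = 1) (c t : ℝ)
    (ρ : Matrix d d ℂ) :
    evolve ((c : ℂ) • (J - 1)) t ρ =
      ((1 - flipProb c t : ℝ) : ℂ) • ρ + ((flipProb c t : ℝ) : ℂ) • J ρ := by
  have hJρ : J (J ρ) = ρ := DFunLike.congr_fun hJ ρ
  have heven := evolve_of_apply_eq_smul (A := J - 1) (c := 0) (ρ := (1 / 2 : ℂ) • (ρ + J ρ))
    (by simp [hJρ, add_comm]) (t * c)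
  have hodd := evolve_of_apply_eq_smul (A := J - 1) (c := -2) (ρ := (1 / 2 : ℂ) • (ρ - J ρ))
    (by simp [hJρ]; module) (t * c)
  have hlin := (isLinearMap_evolve (J - 1) (t * c)).map_add
    ((1 / 2 : ℂ) • (ρ + J ρ)) ((1 / 2 : ℂ) • (ρ - J ρ))
  rw [heven, hodd, show (1 / 2 : ℂ) • (ρ + J ρ) + (1 / 2 : ℂ) • (ρ - J ρ) = ρ by module] at hlin
  rw [evolve_smul, hlin, flipProb, show t * c * -2 = -(2 * (t * c)) by ring, mul_zero,
    Real.exp_zero]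
  push_cast
  module

theorem hasDerivAt_evolve (A : Module.End ℂ (Matrix d d ℂ)) (ρ : Matrix d d ℂ) (t : ℝ) :
    HasDerivAt (fun t : ℝ => evolve A t ρ) (A (evolve A t ρ)) t := by
  cases nonempty_fintype d
  have h := hasDerivAt_exp_smul_const' (𝕂 := ℝ) (Module.End.toContinuousLinearMap _ A) t
  have happly := ((ContinuousLinearMap.apply ℂ (Matrix d d ℂ) ρ).restrictScalars ℝ).hasFDerivAt
    |>.comp_hasDerivAt t h
  simp only [evolve_eq_exp, Complex.coe_smul]
  exact happly

end Evolution

/-! ### States, measurements and channels -/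

section States

variable {e : Type*}

theorem pureState_eq_vecMulVec (ψ : EuclideanSpace ℂ e) :
    pureState ψ = Matrix.vecMulVec ψ (star ψ) := rfl

theorem IsPOVM.comp_equiv [DecidableEq e] {X Y : Type*} [Fintype X] [Fintype Y]
    {E : X → Matrix e e ℂ} (hE : IsPOVM E) (f : Y ≃ X) : IsPOVM fun y => E (f y) :=
  ⟨fun y => hE.1 (f y), by rw [f.sum_comp E, hE.2]⟩

variable [Fintype e]

open scoped MatrixOrder in
theorem exists_eq_conjTranspose_mul_self_of_posSemidef {A : Matrix e e ℂ} (hA : A.PosSemidef) :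
    ∃ B : Matrix e e ℂ, A = Bᴴ * B := by
  classical
  exact CStarAlgebra.nonneg_iff_eq_star_mul_self.mp hA.nonneg

theorem trace_mul_nonneg_of_posSemidef {A B : Matrix e e ℂ} (hA : A.PosSemidef)
    (hB : B.PosSemidef) : 0 ≤ (A * B).trace := by
  obtain ⟨C, rfl⟩ := exists_eq_conjTranspose_mul_self_of_posSemidef hB
  rw [← Matrix.mul_assoc, Matrix.trace_mul_comm, ← Matrix.mul_assoc]
  exact (hA.mul_mul_conjTranspose_same C).trace_nonneg

theorem outcomeProb_nonneg {ρ E : Matrix e e ℂ} (hρ : ρ.PosSemidef) (hE : E.PosSemidef) :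
    0 ≤ outcomeProb ρ E :=
  (Complex.nonneg_iff.1 (trace_mul_nonneg_of_posSemidef hρ hE)).1

theorem trace_mul_eq_outcomeProb {ρ E : Matrix e e ℂ} (hρ : ρ.PosSemidef) (hE : E.PosSemidef) :
    (ρ * E).trace = outcomeProb ρ E :=
  Complex.ext rfl (Complex.nonneg_iff.1 (trace_mul_nonneg_of_posSemidef hρ hE)).2.symm

theorem outcomeProb_add (ρ σ E : Matrix e e ℂ) :
    outcomeProb (ρ + σ) E = outcomeProb ρ E + outcomeProb σ E := by
  simp [outcomeProb, Matrix.add_mul]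

theorem outcomeProb_sub (ρ σ E : Matrix e e ℂ) :
    outcomeProb (ρ - σ) E = outcomeProb ρ E - outcomeProb σ E := by
  simp [outcomeProb, Matrix.sub_mul]

theorem outcomeProb_smul (c : ℝ) (ρ E : Matrix e e ℂ) :
    outcomeProb ((c : ℂ) • ρ) E = c * outcomeProb ρ E := by
  simp [outcomeProb]

theorem outcomeProb_sum {ι : Type*} (s : Finset ι) (ρ : ι → Matrix e e ℂ) (E : Matrix e e ℂ) :
    outcomeProb (∑ i ∈ s, ρ i) E = ∑ i ∈ s, outcomeProb (ρ i) E := by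
  simp [outcomeProb, Matrix.sum_mul, Matrix.trace_sum]

open scoped Matrix.Norms.Elementwise in
theorem hasDerivAt_outcomeProb_map_evolve (A B : Module.End ℂ (Matrix e e ℂ)) (ρ E : Matrix e e ℂ)
    (t : ℝ) :
    HasDerivAt (fun t : ℝ => outcomeProb (B (evolve A t ρ)) E)
      (outcomeProb (B (A (evolve A t ρ))) E) t :=
  let prob : Matrix e e ℂ →ₗ[ℝ] ℝ := Complex.reLm ∘ₗ
    (Matrix.traceLinearMap e ℂ ℂ ∘ₗ LinearMap.mulRight ℂ E ∘ₗ B).restrictScalars ℝ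
  (LinearMap.toContinuousLinearMap prob).hasFDerivAt.comp_hasDerivAt t (hasDerivAt_evolve A ρ t)

theorem hasDerivAt_outcomeProb_evolve (A : Module.End ℂ (Matrix e e ℂ)) (ρ E : Matrix e e ℂ)
    (t : ℝ) :
    HasDerivAt (fun t : ℝ => outcomeProb (evolve A t ρ) E) (outcomeProb (A (evolve A t ρ)) E) t :=
  hasDerivAt_outcomeProb_map_evolve A 1 ρ E t

theorem IsDensityMatrix.mix {ρ σ : Matrix e e ℂ} (hρ : IsDensityMatrix ρ) (hσ : IsDensityMatrix σ)
    {q : ℝ} (h0 : 0 ≤ q) (h1 : q ≤ 1) :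
    IsDensityMatrix (((1 - q : ℝ) : ℂ) • ρ + (q : ℂ) • σ) := by
  refine ⟨(hρ.1.smul ?_).add (hσ.1.smul ?_), ?_⟩
  · exact_mod_cast sub_nonneg.2 h1
  · exact_mod_cast h0
  · simp [hρ.2, hσ.2]

/-- The operation `ρ ↦ L ρ L†` of a single quantum jump. -/
def jump (L : Matrix e e ℂ) : Module.End ℂ (Matrix e e ℂ) :=
  LinearMap.mulLeft ℂ L ∘ₗ LinearMap.mulRight ℂ Lᴴ

theorem jump_apply (L ρ : Matrix e e ℂ) : jump L ρ = L * (ρ * Lᴴ) := rfl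

variable [DecidableEq e]

theorem sum_outcomeProb {X : Type*} [Fintype X] {ρ : Matrix e e ℂ} {E : X → Matrix e e ℂ}
    (hρ : IsDensityMatrix ρ) (hE : IsPOVM E) : ∑ x, outcomeProb ρ (E x) = 1 := by
  simp only [outcomeProb, ← Complex.re_sum, ← Matrix.trace_sum, ← Matrix.mul_sum, hE.2, mul_one,
    hρ.2, Complex.one_re]

theorem IsChannel.isLinearMap {C : Matrix e e ℂ → Matrix e e ℂ} (hC : IsChannel C) :
    IsLinearMap ℂ C := by
  obtain ⟨r, A, -, h⟩ := hC
  constructor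
  · simp only [h, Matrix.mul_add, Matrix.add_mul, Finset.sum_add_distrib, implies_true]
  · simp only [h, Matrix.mul_smul, Matrix.smul_mul, Finset.smul_sum, implies_true]

theorem IsChannel.isDensityMatrix {C : Matrix e e ℂ → Matrix e e ℂ} (hC : IsChannel C)
    {ρ : Matrix e e ℂ} (hρ : IsDensityMatrix ρ) : IsDensityMatrix (C ρ) := by
  obtain ⟨r, A, hA, h⟩ := hC
  rw [h]
  refine ⟨Matrix.posSemidef_sum _ fun j _ => hρ.1.mul_mul_conjTranspose_same _, ?_⟩
  rw [Matrix.trace_sum]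
  simp only [Matrix.trace_mul_comm (_ * ρ), ← Matrix.mul_assoc]
  rw [← Matrix.trace_sum, ← Matrix.sum_mul, hA, one_mul, hρ.2]

theorem IsDensityMatrix.jump {ρ L : Matrix e e ℂ} (hρ : IsDensityMatrix ρ) (hL : Lᴴ * L = 1) :
    IsDensityMatrix (jump L ρ) := by
  rw [jump_apply]
  constructor
  · rw [← Matrix.mul_assoc]
    exact hρ.1.mul_mul_conjTranspose_same _
  · rw [Matrix.trace_mul_comm, Matrix.mul_assoc, hL, mul_one, hρ.2]

theorem dissipator_eq_jump_sub_one {L : Matrix e e ℂ} (hL : Lᴴ * L = 1) :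
    dissipator L = jump L - 1 := by
  rw [dissipator, hL, jump]
  congr 1
  ext1 ρ
  simp only [LinearMap.smul_apply, LinearMap.add_apply, LinearMap.mulLeft_apply,
    LinearMap.mulRight_apply, one_mul, mul_one, Module.End.one_apply]
  module

theorem outcomeProb_dissipator {L : Matrix e e ℂ} (hL : Lᴴ * L = 1) (ρ E : Matrix e e ℂ) :
    outcomeProb (dissipator L ρ) E = outcomeProb (jump L ρ) E - outcomeProb ρ E := by
  rw [dissipator_eq_jump_sub_one hL, LinearMap.sub_apply, outcomeProb_sub, Module.End.one_apply]

end States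

/-! ### Families of involutions that commute up to sign -/

section Involutions

variable {e : Type*} [Fintype e] [DecidableEq e]

/-- Hermitian unitary operators which pairwise commute or anticommute. This is all that the upper
bounds on the Fisher information use about Pauli operators. -/
structure IsPauliFamily {ι : Type*} (L : ι → Matrix e e ℂ) : Prop where
  conjTranspose_eq : ∀ i, (L i)ᴴ = L i
  mul_self : ∀ i, L i * L i = 1
  comm : ∀ i j, L i * L j = L j * L i ∨ L i * L j = -(L j * L i)

namespace IsPauliFamily

variable {ι κ : Type*} {L : ι → Matrix e e ℂ}

theorem comp (h : IsPauliFamily L) (f : κ → ι) : IsPauliFamily (fun k => L (f k)) where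
  conjTranspose_eq _ := h.conjTranspose_eq _
  mul_self _ := h.mul_self _
  comm _ _ := h.comm _ _

theorem sumElim (h : IsPauliFamily L) {ι' : Type*} (f : κ → ι) (g : ι' → ι) :
    IsPauliFamily (Sum.elim (fun k => L (f k)) fun k => L (g k)) := by
  have hcomp := h.comp (Sum.elim f g)
  rwa [← Function.comp_def, Sum.comp_elim] at hcomp

theorem conjTranspose_mul_self (h : IsPauliFamily L) (i : ι) : (L i)ᴴ * L i = 1 := by
  rw [h.conjTranspose_eq, h.mul_self]

theorem jump_mul_self (h : IsPauliFamily L) (i : ι) : jump (L i) * jump (L i) = 1 := by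
  ext1 ρ
  rw [Module.End.mul_apply, jump_apply, jump_apply, h.conjTranspose_eq, ← Matrix.mul_assoc,
    ← Matrix.mul_assoc, h.mul_self, one_mul, Matrix.mul_assoc, h.mul_self, mul_one,
    Module.End.one_apply]

-- The sign in `A B = ± B A` occurs on both sides of the state and cancels.
theorem jump_commute (h : IsPauliFamily L) (i j : ι) : Commute (jump (L i)) (jump (L j)) := by
  have jump_jump : ∀ A B ρ : Matrix e e ℂ, A * (B * (ρ * B) * A) = A * B * ρ * (B * A) := by
    intro A B ρ
    simp only [Matrix.mul_assoc]
  ext1 ρ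
  simp only [Module.End.mul_apply, jump_apply, h.conjTranspose_eq, jump_jump]
  rcases h.comm i j with h | h <;> simp [h]

theorem dissipator_eq (h : IsPauliFamily L) (i : ι) : dissipator (L i) = jump (L i) - 1 :=
  dissipator_eq_jump_sub_one (h.conjTranspose_mul_self i)

theorem dissipator_commute (h : IsPauliFamily L) (i j : ι) :
    Commute (dissipator (L i)) (dissipator (L j)) := by
  rw [h.dissipator_eq, h.dissipator_eq]
  exact ((h.jump_commute i j).sub_left (Commute.one_left _)).sub_right (Commute.one_right _)

theorem evolve_sum_insert [DecidableEq ι] (h : IsPauliFamily L) (c : ι → ℝ) {i : ι} {s : Finset ι}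
    (hi : i ∉ s) (t : ℝ) (ρ : Matrix e e ℂ) :
    evolve (∑ j ∈ insert i s, (c j : ℂ) • dissipator (L j)) t ρ =
      ((1 - flipProb (c i) t : ℝ) : ℂ) • evolve (∑ j ∈ s, (c j : ℂ) • dissipator (L j)) t ρ
      + ((flipProb (c i) t : ℝ) : ℂ) •
        jump (L i) (evolve (∑ j ∈ s, (c j : ℂ) • dissipator (L j)) t ρ) := by
  rw [Finset.sum_insert hi, evolve_add_of_commute, h.dissipator_eq i,
    evolve_smul_involution (h.jump_mul_self i)]
  exact Commute.sum_right _ _ _ fun j _ =>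
    ((h.dissipator_commute i j).smul_left _).smul_right _

theorem isDensityMatrix_evolve_sum (h : IsPauliFamily L) {c : ι → ℝ} (hc : ∀ i, 0 ≤ c i) {t : ℝ}
    (ht : 0 ≤ t) (s : Finset ι) {ρ : Matrix e e ℂ} (hρ : IsDensityMatrix ρ) :
    IsDensityMatrix (evolve (∑ j ∈ s, (c j : ℂ) • dissipator (L j)) t ρ) := by
  classical
  induction s using Finset.induction_on with
  | empty => simpa [evolve_zero] using hρ
  | insert i s hi ih =>
    rw [h.evolve_sum_insert c hi]
    exact ih.mix (ih.jump (h.conjTranspose_mul_self i)) (flipProb_nonneg (mul_nonneg ht (hc i)))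
      (flipProb_lt_one _ _).le

section SignalAndNoise

variable {Ls : ι → Matrix e e ℂ} {Ln : κ → Matrix e e ℂ}

theorem signal (h : IsPauliFamily (Sum.elim Ls Ln)) : IsPauliFamily Ls := h.comp Sum.inl

theorem noise (h : IsPauliFamily (Sum.elim Ls Ln)) : IsPauliFamily Ln := h.comp Sum.inr

variable [Fintype ι] [Fintype κ]

theorem commute_signal_noise (h : IsPauliFamily (Sum.elim Ls Ln)) (γ : κ → ℝ) :
    Commute (∑ j, dissipator (Ls j)) (∑ k, ((γ k : ℝ) : ℂ) • dissipator (Ln k)) :=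
  Commute.sum_left _ _ _ fun j _ => Commute.sum_right _ _ _ fun k _ =>
    (h.dissipator_commute (Sum.inl j) (Sum.inr k)).smul_right _

theorem evolve_generator (h : IsPauliFamily (Sum.elim Ls Ln)) (γ : κ → ℝ) (θ t : ℝ)
    (ρ : Matrix e e ℂ) :
    evolve (generator Ls Ln γ θ) t ρ = evolve (((θ ^ 2 : ℝ) : ℂ) • ∑ j, dissipator (Ls j)) t
      (evolve (∑ k, ((γ k : ℝ) : ℂ) • dissipator (Ln k)) t ρ) :=
  evolve_add_of_commute ((h.commute_signal_noise γ).smul_left _) t ρ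

end SignalAndNoise

section Ancilla

variable (α : Type*) [Fintype α] [DecidableEq α]

theorem withAncilla (h : IsPauliFamily L) : IsPauliFamily (fun i => withAncilla α (L i)) where
  conjTranspose_eq i := by
    rw [_root_.withAncilla, Matrix.conjTranspose_kronecker, h.conjTranspose_eq,
      Matrix.conjTranspose_one]
  mul_self i := by
    rw [_root_.withAncilla, ← Matrix.mul_kronecker_mul, h.mul_self, one_mul,
      Matrix.one_kronecker_one]
  comm i j := by
    simp only [_root_.withAncilla, ← Matrix.mul_kronecker_mul]
    exact (h.comm i j).imp (fun h => by rw [h]) (fun h => by rw [h]; ext; simp)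

theorem sumElim_withAncilla {Ls : ι → Matrix e e ℂ} {Ln : κ → Matrix e e ℂ}
    (h : IsPauliFamily (Sum.elim Ls Ln)) :
    IsPauliFamily (Sum.elim (fun j => _root_.withAncilla α (Ls j))
      (fun k => _root_.withAncilla α (Ln k))) :=
  Sum.comp_elim (_root_.withAncilla α) Ls Ln ▸ h.withAncilla α

end Ancilla

end IsPauliFamily

end Involutions

/-! ### Simulation by independent coins -/

section FlipMixture

variable {e : Type*} [Fintype e]

/-- The states `F θ` are obtained from `k` independent coins, which show `true` with the
probability `flipProb (θ ^ 2) t`, by preparing a state that depends on the coins but not on `θ`.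
Each use of a signal operator for a time `t` amounts to one such coin, so that `F θ` carries at most
the Fisher information of `k` coins. -/
def IsFlipMixture (t : ℝ) (k : ℕ) (F : ℝ → Matrix e e ℂ) : Prop :=
  ∃ σ : (Fin k → Bool) → Matrix e e ℂ, (∀ ε, IsDensityMatrix (σ ε)) ∧
    ∀ s, F s = ∑ ε, ((iidLaw (bernoulliLaw (flipProb (s ^ 2) t)) k ε : ℝ) : ℂ) • σ ε

namespace IsFlipMixture

variable {t : ℝ} {k : ℕ} {F : ℝ → Matrix e e ℂ}

theorem const {ρ : Matrix e e ℂ} (hρ : IsDensityMatrix ρ) : IsFlipMixture t 0 fun _ => ρ :=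
  ⟨fun _ => ρ, fun _ => hρ, fun s => by simp [iidLaw]⟩

theorem map (hF : IsFlipMixture t k F) {G : Matrix e e ℂ → Matrix e e ℂ} (hlin : IsLinearMap ℂ G)
    (hG : ∀ ρ, IsDensityMatrix ρ → IsDensityMatrix (G ρ)) :
    IsFlipMixture t k fun s => G (F s) := by
  obtain ⟨σ, hσ, h⟩ := hF
  refine ⟨fun ε => G (σ ε), fun ε => hG _ (hσ ε), fun s => ?_⟩
  simp only [h, ← hlin.mk'_apply, map_sum, map_smul]

theorem posSemidef (hF : IsFlipMixture t k F) (ht : 0 ≤ t) (s : ℝ) : (F s).PosSemidef := by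
  obtain ⟨σ, hσ, h⟩ := hF
  rw [h]
  refine Matrix.posSemidef_sum _ fun ε _ => (hσ ε).1.smul ?_
  exact_mod_cast ((isDifferentiableLaw_flip ht 0).iid k).nonneg s ε

theorem exists_outcomeProb_eq (hF : IsFlipMixture t k F) :
    ∃ σ : (Fin k → Bool) → Matrix e e ℂ, (∀ ε, IsDensityMatrix (σ ε)) ∧ ∀ s E,
      outcomeProb (F s) E =
        ∑ ε, iidLaw (bernoulliLaw (flipProb (s ^ 2) t)) k ε * outcomeProb (σ ε) E := by
  obtain ⟨σ, hσ, h⟩ := hF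
  exact ⟨σ, hσ, fun s E => by simp only [h, outcomeProb_sum, outcomeProb_smul]⟩

variable [DecidableEq e]

theorem flip (hF : IsFlipMixture t k F) {L : Matrix e e ℂ} (hL : Lᴴ * L = 1) :
    IsFlipMixture t (k + 1) fun s => ((1 - flipProb (s ^ 2) t : ℝ) : ℂ) • F s
      + ((flipProb (s ^ 2) t : ℝ) : ℂ) • jump L (F s) := by
  obtain ⟨σ, hσ, h⟩ := hF
  let τ : Bool × (Fin k → Bool) → Matrix e e ℂ := fun z => bif z.1 then jump L (σ z.2) else σ z.2
  have hτ : ∀ z, IsDensityMatrix (τ z)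
    | (true, ε) => (hσ ε).jump hL
    | (false, ε) => hσ ε
  refine ⟨fun ε => τ ((Fin.consEquiv fun _ => Bool).symm ε), fun ε => hτ _, fun s => ?_⟩
  rw [← (Fin.consEquiv fun _ => Bool).sum_comp, Fintype.sum_prod_type]
  simp only [iidLaw_cons, Equiv.symm_apply_apply, Fintype.sum_bool, τ, bernoulliLaw, cond_true,
    cond_false, h, map_sum, map_smul, Finset.smul_sum, smul_smul, Complex.ofReal_mul]
  exact add_comm _ _

theorem evolve_sum {ι : Type*} {L : ι → Matrix e e ℂ} (hL : IsPauliFamily L)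
    (hF : IsFlipMixture t k F) (s : Finset ι) :
    IsFlipMixture t (k + s.card) fun θ =>
      evolve (∑ j ∈ s, ((θ ^ 2 : ℝ) : ℂ) • dissipator (L j)) t (F θ) := by
  classical
  induction s using Finset.induction_on with
  | empty => simpa [evolve_zero] using hF
  | insert i s hi ih =>
    simp only [hL.evolve_sum_insert (fun _ => _ ^ 2) hi, Finset.card_insert_of_notMem hi]
    exact ih.flip (hL.conjTranspose_mul_self i)

section Measurement

variable {X : Type*} [Fintype X] {E : X → Matrix e e ℂ} {θ : ℝ}

theorem isDifferentiableLaw (hF : IsFlipMixture t k F) (hE : IsPOVM E) (ht : 0 ≤ t) (θ : ℝ) :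
    IsDifferentiableLaw (fun s x => outcomeProb (F s) (E x)) θ := by
  obtain ⟨σ, hσ, h⟩ := hF.exists_outcomeProb_eq
  simp only [h]
  exact ((isDifferentiableLaw_flip ht θ).iid k).postprocess
    (fun ε x => outcomeProb_nonneg (hσ ε).1 (hE.1 x)) fun ε => sum_outcomeProb (hσ ε) hE

theorem fisherInfo_le (hF : IsFlipMixture t k F) (hE : IsPOVM E) (ht : 0 ≤ t) (hθ : θ ≠ 0) :
    fisherInfo (fun s x => outcomeProb (F s) (E x)) θ ≤ k * (4 * t) := by
  obtain ⟨σ, hσ, h⟩ := hF.exists_outcomeProb_eq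
  simp only [h]
  have hcoin := isDifferentiableLaw_flip ht θ
  calc _ ≤ fisherInfo (fun s => iidLaw (bernoulliLaw (flipProb (s ^ 2) t)) k) θ :=
        fisherInfo_postprocess_le (hcoin.iid k)
          (fun ε x => outcomeProb_nonneg (hσ ε).1 (hE.1 x)) fun ε => sum_outcomeProb (hσ ε) hE
    _ = k * fisherInfo (fun s => bernoulliLaw (flipProb (s ^ 2) t)) θ := fisherInfo_iid hcoin k
    _ ≤ k * (4 * t) := mul_le_mul_of_nonneg_left (fisherInfo_flip_le ht hθ) (Nat.cast_nonneg k)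

end Measurement

section Generator

variable {ι κ : Type*} [Fintype ι] [Fintype κ] {γ : κ → ℝ}

theorem evolve_generator {Ls : ι → Matrix e e ℂ} {Ln : κ → Matrix e e ℂ} (hF : IsFlipMixture t k F)
    (h : IsPauliFamily (Sum.elim Ls Ln)) (hγ : ∀ k, 0 ≤ γ k) (ht : 0 ≤ t) :
    IsFlipMixture t (k + Fintype.card ι) fun θ => evolve (generator Ls Ln γ θ) t (F θ) := by
  simp only [h.evolve_generator, Finset.smul_sum]
  exact (hF.map (isLinearMap_evolve _ t) fun ρ hρ =>
    h.noise.isDensityMatrix_evolve_sum hγ ht _ hρ).evolve_sum h.signal Finset.univ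

variable {d α : Type*} [Fintype d] [DecidableEq d] [Fintype α] [DecidableEq α]
  {Ls : ι → Matrix d d ℂ} {Ln : κ → Matrix d d ℂ}

theorem extendedEvolution {F : ℝ → Matrix (d × α) (d × α) ℂ} (hF : IsFlipMixture t k F)
    (h : IsPauliFamily (Sum.elim Ls Ln)) (hγ : ∀ k, 0 ≤ γ k) (ht : 0 ≤ t) :
    IsFlipMixture t (k + Fintype.card ι) fun θ => extendedEvolution α Ls Ln γ θ t (F θ) :=
  hF.evolve_generator (h.sumElim_withAncilla α) hγ ht

theorem sequentialState (h : IsPauliFamily (Sum.elim Ls Ln)) (hγ : ∀ k, 0 ≤ γ k) (ht : 0 ≤ t)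
    {ρ : Matrix (d × α) (d × α) ℂ} (hρ : IsDensityMatrix ρ)
    {C : ℕ → Matrix (d × α) (d × α) ℂ → Matrix (d × α) (d × α) ℂ} (hC : ∀ i, IsChannel (C i))
    (M : ℕ) :
    IsFlipMixture t (M * Fintype.card ι) fun θ =>
      sequentialState (_root_.extendedEvolution α Ls Ln γ θ t) C ρ M := by
  induction M with
  | zero =>
    rw [zero_mul]
    exact const hρ
  | succ M ih =>
    rw [add_mul, one_mul]
    exact (ih.extendedEvolution h hγ ht).map (hC M).isLinearMap
      fun ρ hρ => (hC M).isDensityMatrix hρ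

end Generator

end IsFlipMixture

end FlipMixture

/-! ### Upper bounds on the Fisher information -/

section UpperBounds

variable {d α ι κ : Type*} [Fintype d] [DecidableEq d] [Fintype α] [DecidableEq α] [Fintype ι]
  [Fintype κ] {Ls : ι → Matrix d d ℂ} {Ln : κ → Matrix d d ℂ} {γ : κ → ℝ} {T θ : ℝ} {M : ℕ}

theorem sequentialQFI_le (h : IsPauliFamily (Sum.elim Ls Ln)) (hγ : ∀ k, 0 ≤ γ k) (hT : 0 ≤ T)
    (hθ : θ ≠ 0) (hM : M ≠ 0) :
    sequentialQFI Ls Ln γ T θ M ≤ ENNReal.ofReal (4 * Fintype.card ι * T) := by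
  refine iSup_le fun α => iSup_le fun _ => iSup_le fun _ => iSup_le fun ρ => iSup_le fun hρ =>
    iSup_le fun C => iSup_le fun hC => iSup_le fun m => iSup_le fun E => iSup_le fun hE =>
    ENNReal.ofReal_le_ofReal ?_
  have ht : 0 ≤ T / M := by positivity
  refine ((IsFlipMixture.sequentialState h hγ ht hρ hC M).fisherInfo_le hE ht hθ).trans_eq ?_
  push_cast
  field_simp

variable {X : Type*} [Fintype X] {E : X → Matrix (d × α) (d × α) ℂ} {ψ : EuclideanSpace ℂ (d × α)}

theorem measureResetFisherInfo_eq (h : IsPauliFamily (Sum.elim Ls Ln)) (hγ : ∀ k, 0 ≤ γ k)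
    (hT : 0 ≤ T) (hψ : IsDensityMatrix (pureState ψ)) (hE : IsPOVM E) (θ : ℝ) (M : ℕ) :
    measureResetFisherInfo Ls Ln γ T ψ E θ M = ENNReal.ofReal (M * fisherInfo (fun s x =>
      outcomeProb (extendedEvolution α Ls Ln γ s (T / M) (pureState ψ)) (E x)) θ) := by
  have ht : 0 ≤ T / M := by positivity
  rw [measureResetFisherInfo, fisherInfo_iid
    (((IsFlipMixture.const hψ).extendedEvolution h hγ ht).isDifferentiableLaw hE ht θ)]

theorem measureResetFisherInfo_le (h : IsPauliFamily (Sum.elim Ls Ln)) (hγ : ∀ k, 0 ≤ γ k)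
    (hT : 0 ≤ T) (hψ : IsDensityMatrix (pureState ψ)) (hE : IsPOVM E) (hθ : θ ≠ 0) (hM : M ≠ 0) :
    measureResetFisherInfo Ls Ln γ T ψ E θ M ≤ ENNReal.ofReal (4 * Fintype.card ι * T) := by
  rw [measureResetFisherInfo_eq h hγ hT hψ hE]
  have ht : 0 ≤ T / M := by positivity
  have hround := ((IsFlipMixture.const hψ).extendedEvolution h hγ ht).fisherInfo_le hE ht hθ
  refine ENNReal.ofReal_le_ofReal ((mul_le_mul_of_nonneg_left hround M.cast_nonneg).trans_eq ?_)
  rw [zero_add]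
  field_simp

theorem measureResetQFI_le (h : IsPauliFamily (Sum.elim Ls Ln)) (hγ : ∀ k, 0 ≤ γ k)
    (hT : 0 ≤ T) (hψ : IsDensityMatrix (pureState ψ)) (hθ : θ ≠ 0) (hM : M ≠ 0) :
    measureResetQFI Ls Ln γ T ψ θ M ≤ ENNReal.ofReal (4 * Fintype.card ι * T) :=
  iSup_le fun _ => iSup_le fun _ => iSup_le fun hE =>
    measureResetFisherInfo_le h hγ hT hψ hE hθ hM

end UpperBounds

/-! ### Sequential strategies simulate measure-and-reset strategies -/

section Record

variable {d α R : Type*}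

/-- The operator `X ⊗ D` on the qubits, the ancilla and a further register `R`. -/
def attach (D : Matrix R R ℂ) : Matrix (d × α) (d × α) ℂ →ₗ[ℂ]
    Matrix (d × (α × R)) (d × (α × R)) ℂ where
  toFun X := (X ⊗ₖ D).submatrix (Equiv.prodAssoc d α R).symm (Equiv.prodAssoc d α R).symm
  map_add' X Y := by rw [Matrix.add_kronecker]; rfl
  map_smul' c X := by rw [Matrix.smul_kronecker]; rfl

theorem attach_apply (D : Matrix R R ℂ) (X : Matrix (d × α) (d × α) ℂ) :
    attach D X =
      (X ⊗ₖ D).submatrix (Equiv.prodAssoc d α R).symm (Equiv.prodAssoc d α R).symm := rfl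

theorem attach_conjTranspose (D : Matrix R R ℂ) (X : Matrix (d × α) (d × α) ℂ) :
    (attach D X)ᴴ = attach Dᴴ Xᴴ := by
  rw [attach_apply, Matrix.conjTranspose_submatrix, Matrix.conjTranspose_kronecker, attach_apply]

theorem attach_zero (X : Matrix (d × α) (d × α) ℂ) : attach (0 : Matrix R R ℂ) X = 0 := by
  rw [attach_apply, Matrix.kronecker_zero, Matrix.submatrix_zero, Pi.zero_apply, Pi.zero_apply]

theorem sum_attach {ι : Type*} (s : Finset ι) (D : ι → Matrix R R ℂ)
    (X : Matrix (d × α) (d × α) ℂ) : ∑ i ∈ s, attach (D i) X = attach (∑ i ∈ s, D i) X := by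
  ext
  simp [attach_apply, Matrix.sum_apply, Finset.mul_sum]

theorem attach_one_one [DecidableEq d] [DecidableEq α] [DecidableEq R] :
    attach (1 : Matrix R R ℂ) (1 : Matrix (d × α) (d × α) ℂ) = 1 := by
  rw [attach_apply, Matrix.one_kronecker_one, Matrix.submatrix_one_equiv]

theorem withAncilla_prod [DecidableEq α] [DecidableEq R] (L : Matrix d d ℂ) :
    withAncilla (α × R) L = attach (1 : Matrix R R ℂ) (withAncilla α L) := by
  rw [withAncilla, withAncilla, ← Matrix.one_kronecker_one, attach_apply,
    ← Matrix.kronecker_assoc]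
  rfl

theorem posSemidef_attach [Finite d] [Finite α] [Finite R] {D : Matrix R R ℂ}
    {X : Matrix (d × α) (d × α) ℂ} (hD : D.PosSemidef) (hX : X.PosSemidef) :
    (attach D X).PosSemidef :=
  (hX.kronecker hD).submatrix _

theorem posSemidef_single_self [DecidableEq R] (r : R) :
    (Matrix.single r r (1 : ℂ)).PosSemidef := by
  rw [← Matrix.diagonal_single]
  exact Matrix.PosSemidef.diagonal (Pi.single_nonneg.2 zero_le_one)

theorem isPOVM_attach_single [Finite d] [DecidableEq d] [Finite α] [DecidableEq α] [Fintype R]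
    [DecidableEq R] : IsPOVM fun r : R => attach (d := d) (α := α) (Matrix.single r r (1 : ℂ)) 1 :=
  ⟨fun r => posSemidef_attach (posSemidef_single_self r) Matrix.PosSemidef.one, by
    rw [sum_attach, Matrix.sum_single_one, attach_one_one]⟩

variable [Fintype d] [Fintype α] [Fintype R]

theorem attach_mul (D D' : Matrix R R ℂ) (X X' : Matrix (d × α) (d × α) ℂ) :
    attach D X * attach D' X' = attach (D * D') (X * X') := by
  rw [attach_apply, attach_apply, attach_apply, Matrix.submatrix_mul_equiv,
    Matrix.mul_kronecker_mul]

theorem jump_attach (D D' : Matrix R R ℂ) (X ρ : Matrix (d × α) (d × α) ℂ) :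
    jump (attach D X) (attach D' ρ) = attach (jump D D') (jump X ρ) := by
  simp only [jump_apply, attach_conjTranspose, attach_mul]

theorem trace_attach (D : Matrix R R ℂ) (X : Matrix (d × α) (d × α) ℂ) :
    (attach D X).trace = X.trace * D.trace := by
  rw [← Matrix.trace_kronecker, attach_apply]
  exact (Equiv.prodAssoc d α R).symm.sum_comp fun i => (X ⊗ₖ D) i i

theorem isDensityMatrix_attach_single [DecidableEq R] {ρ : Matrix (d × α) (d × α) ℂ}
    (hρ : IsDensityMatrix ρ) (r : R) : IsDensityMatrix (attach (Matrix.single r r 1) ρ) :=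
  ⟨posSemidef_attach (posSemidef_single_self r) hρ.1, by
    rw [trace_attach, hρ.2, Matrix.trace_single_eq_same, mul_one]⟩

theorem outcomeProb_sum_attach_single [DecidableEq d] [DecidableEq α] [DecidableEq R]
    {ρ : Matrix (d × α) (d × α) ℂ} (hρ : ρ.trace = 1)
    (w : R → ℝ) (r : R) :
    outcomeProb (∑ s, ((w s : ℝ) : ℂ) • attach (Matrix.single s s 1) ρ)
      (attach (Matrix.single r r 1) 1) = w r := by
  simp only [outcomeProb_sum, outcomeProb_smul]
  rw [Finset.sum_eq_single r]
  · simp [outcomeProb, attach_mul, trace_attach, hρ]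
  · intro s _ hs
    rw [outcomeProb, attach_mul, Matrix.single_mul_single_of_ne _ _ _ _ hs, attach_zero]
    simp
  · simp

variable [DecidableEq d] [DecidableEq α] [DecidableEq R]

theorem dissipator_attach (L : Matrix d d ℂ) (D : Matrix R R ℂ) (X : Matrix (d × α) (d × α) ℂ) :
    dissipator (withAncilla (α × R) L) (attach D X) =
      attach D (dissipator (withAncilla α L) X) := by
  simp only [dissipator, LinearMap.sub_apply, LinearMap.smul_apply, LinearMap.add_apply,
    LinearMap.comp_apply, LinearMap.mulLeft_apply, LinearMap.mulRight_apply, withAncilla_prod,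
    attach_conjTranspose, attach_mul, Matrix.conjTranspose_one, one_mul, mul_one, map_sub, map_smul,
    map_add]

theorem extendedEvolution_attach {ι κ : Type*} [Fintype ι] [Fintype κ] (Ls : ι → Matrix d d ℂ)
    (Ln : κ → Matrix d d ℂ) (γ : κ → ℝ) (θ t : ℝ) (D : Matrix R R ℂ)
    (X : Matrix (d × α) (d × α) ℂ) :
    extendedEvolution (α × R) Ls Ln γ θ t (attach D X) =
      attach D (extendedEvolution α Ls Ln γ θ t X) := by
  refine evolve_map (attach D) (fun ρ => ?_) t X
  simp only [generator, LinearMap.add_apply, LinearMap.smul_apply, LinearMap.sum_apply,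
    dissipator_attach, map_add, map_smul, map_sum]

end Record

section Reset

variable {e : Type*} [Fintype e]

/-- A Kraus operator of the measurement of the effect `Bᴴ * B`, followed by the preparation of
`ψ`. -/
def resetKraus (ψ : EuclideanSpace ℂ e) (B : Matrix e e ℂ) (i : e) : Matrix e e ℂ :=
  Matrix.vecMulVec ψ (B i)

theorem sum_conjTranspose_mul_resetKraus {ψ : EuclideanSpace ℂ e} (hψ : (pureState ψ).trace = 1)
    (B : Matrix e e ℂ) : ∑ i, (resetKraus ψ B i)ᴴ * resetKraus ψ B i = Bᴴ * B := by
  have hnorm : star ψ.ofLp ⬝ᵥ ψ = 1 := by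
    rw [dotProduct_comm, ← Matrix.trace_vecMulVec, ← pureState_eq_vecMulVec, hψ]
  ext a b
  simp [resetKraus, Matrix.conjTranspose_vecMulVec, Matrix.vecMulVec_mul_vecMulVec, hnorm,
    Matrix.sum_apply, Matrix.mul_apply, Matrix.vecMulVec_apply]

theorem sum_jump_resetKraus (ψ : EuclideanSpace ℂ e) (B ρ : Matrix e e ℂ) :
    ∑ i, jump (resetKraus ψ B i) ρ = (ρ * (Bᴴ * B)).trace • pureState ψ := by
  have hjump : ∀ i, jump (resetKraus ψ B i) ρ = (B * ρ * Bᴴ) i i • pureState ψ := fun i => by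
    rw [jump_apply, resetKraus, Matrix.conjTranspose_vecMulVec, Matrix.mul_vecMulVec,
      Matrix.vecMulVec_mul_vecMulVec, Matrix.vecMulVec_smul, Matrix.mul_assoc]
    rfl
  rw [← Matrix.mul_assoc, Matrix.trace_mul_comm, ← Matrix.mul_assoc]
  simp only [hjump, ← Finset.sum_smul]
  rfl

end Reset

section Simulation

theorem IsChannel.sum_jump {e J : Type*} [Fintype e] [DecidableEq e] [Fintype J]
    {A : J → Matrix e e ℂ} (hA : ∑ j, (A j)ᴴ * A j = 1) :
    IsChannel (∑ j, jump (A j) : Module.End ℂ (Matrix e e ℂ)) := by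
  let f := (Fintype.equivFin J).symm
  refine ⟨Fintype.card J, fun i => A (f i), ?_, fun ρ => ?_⟩
  · rw [f.sum_comp fun j => (A j)ᴴ * A j, hA]
  · rw [f.sum_comp fun j => A j * ρ * (A j)ᴴ, LinearMap.sum_apply]
    simp only [jump_apply, Matrix.mul_assoc]

variable {X : Type*} {M k : ℕ}

/-- The record `r` of `M` outcomes with the entry number `k` replaced by `x`. -/
def writeRecord (k : ℕ) (x : X) (r : Fin M → X) : Fin M → X :=
  fun i => if i.val = k then x else r i

/-- The record of the outcomes `h` of the first `k` of `M` rounds, padded with `x₀`. -/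
def paddedRecord (x₀ : X) (h : Fin k → X) : Fin M → X :=
  fun i => if hi : i.val < k then h ⟨i.val, hi⟩ else x₀

theorem writeRecord_paddedRecord (x₀ x : X) (h : Fin k → X) :
    writeRecord k x (paddedRecord (M := M) x₀ h) =
      paddedRecord x₀ (Fin.snoc (α := fun _ => X) h x) := by
  funext i
  simp only [writeRecord, paddedRecord, Fin.snoc]
  rcases lt_trichotomy i.val k with hi | hi | hi
  · simp [hi, hi.ne, hi.trans k.lt_succ_self]
  · simp [hi]
  · rw [if_neg hi.ne', dif_neg (by omega), dif_neg (by omega)]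

theorem paddedRecord_self (x₀ : X) (h : Fin M → X) : paddedRecord x₀ h = h := by
  funext i
  simp [paddedRecord]

theorem iidLaw_snoc (p : X → ℝ) (h : Fin k → X) (x : X) :
    iidLaw p (k + 1) (Fin.snoc (α := fun _ => X) h x) = iidLaw p k h * p x := by
  simp [iidLaw, Fin.prod_univ_castSucc]

variable {d α : Type*} [Fintype d] [Fintype α] [Fintype X] [DecidableEq X]

/-- A Kraus operator of the control operation which measures, writes the outcome `x` to the
entry number `k` of the record `r`, and resets the state to `ψ`, where `j = (r, x, i)`. -/
def recordResetKraus (ψ : EuclideanSpace ℂ (d × α)) (B : X → Matrix (d × α) (d × α) ℂ) (k : ℕ)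
    (j : (Fin M → X) × X × (d × α)) :
    Matrix (d × (α × (Fin M → X))) (d × (α × (Fin M → X))) ℂ :=
  attach (Matrix.single (writeRecord k j.2.1 j.1) j.1 1) (resetKraus ψ (B j.2.1) j.2.2)

/-- The control operation which measures, writes the outcome to the entry number `k` of the record,
and resets the state to `ψ`. -/
def recordReset (ψ : EuclideanSpace ℂ (d × α)) (B : X → Matrix (d × α) (d × α) ℂ) (k : ℕ) :
    Module.End ℂ (Matrix (d × (α × (Fin M → X))) (d × (α × (Fin M → X))) ℂ) :=
  ∑ j, jump (recordResetKraus ψ B k j)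

theorem recordReset_attach_single (ψ : EuclideanSpace ℂ (d × α))
    (B : X → Matrix (d × α) (d × α) ℂ) (k : ℕ) (r : Fin M → X) (ρ : Matrix (d × α) (d × α) ℂ) :
    recordReset ψ B k (attach (Matrix.single r r 1) ρ) =
      ∑ x, (ρ * ((B x)ᴴ * B x)).trace •
        attach (Matrix.single (writeRecord k x r) (writeRecord k x r) 1) (pureState ψ) := by
  rw [recordReset, LinearMap.sum_apply, Fintype.sum_prod_type, Finset.sum_eq_single r]
  · rw [Fintype.sum_prod_type]
    refine Finset.sum_congr rfl fun x _ => ?_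
    simp only [recordResetKraus, jump_attach, ← map_sum, sum_jump_resetKraus, map_smul]
    simp only [jump_apply, Matrix.conjTranspose_single, Matrix.single_mul_single_same, star_one,
      mul_one]
  · intro s _ hs
    refine Finset.sum_eq_zero fun z _ => ?_
    rw [recordResetKraus, jump_attach, jump_apply, ← Matrix.mul_assoc,
      Matrix.single_mul_single_of_ne _ _ _ _ hs, Matrix.zero_mul, attach_zero]
  · simp

theorem sequentialState_recordReset {ψ : EuclideanSpace ℂ (d × α)}
    (B : X → Matrix (d × α) (d × α) ℂ) (x₀ : X)
    {Φ : Matrix (d × α) (d × α) ℂ → Matrix (d × α) (d × α) ℂ}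
    {Φ' : Matrix (d × (α × (Fin M → X))) (d × (α × (Fin M → X))) ℂ →
      Matrix (d × (α × (Fin M → X))) (d × (α × (Fin M → X))) ℂ} (hlin : IsLinearMap ℂ Φ')
    (hΦ : ∀ D ρ, Φ' (attach D ρ) = attach D (Φ ρ)) {p : X → ℝ}
    (hp : ∀ x, (Φ (pureState ψ) * ((B x)ᴴ * B x)).trace = p x) (k : ℕ) :
    sequentialState Φ' (fun k => recordReset ψ B k)
      (attach (Matrix.single (fun _ => x₀) (fun _ => x₀) 1) (pureState ψ)) k =
      ∑ h : Fin k → X, ((iidLaw p k h : ℝ) : ℂ) •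
        attach (Matrix.single (paddedRecord x₀ h) (paddedRecord x₀ h) 1) (pureState ψ) := by
  induction k with
  | zero =>
    simp only [sequentialState, Fintype.sum_unique, iidLaw, Finset.univ_eq_empty,
      Finset.prod_empty, Complex.ofReal_one, one_smul]
    rfl
  | succ k ih =>
    rw [sequentialState, ih, ← hlin.mk'_apply]
    simp only [map_sum, map_smul]
    simp only [hlin.mk'_apply, hΦ, recordReset_attach_single, hp, writeRecord_paddedRecord,
      Finset.smul_sum, smul_smul, ← Complex.ofReal_mul, ← iidLaw_snoc]
    rw [← (Fin.snocEquiv fun _ => X).sum_comp, Fintype.sum_prod_type, Finset.sum_comm]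
    rfl

variable [DecidableEq d] [DecidableEq α]

theorem outcomeProb_sequentialState_recordReset {ψ : EuclideanSpace ℂ (d × α)}
    (hψ : (pureState ψ).trace = 1) (B : X → Matrix (d × α) (d × α) ℂ) (x₀ : X)
    {Φ : Matrix (d × α) (d × α) ℂ → Matrix (d × α) (d × α) ℂ}
    {Φ' : Matrix (d × (α × (Fin M → X))) (d × (α × (Fin M → X))) ℂ →
      Matrix (d × (α × (Fin M → X))) (d × (α × (Fin M → X))) ℂ} (hlin : IsLinearMap ℂ Φ')
    (hΦ : ∀ D ρ, Φ' (attach D ρ) = attach D (Φ ρ)) {p : X → ℝ}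
    (hp : ∀ x, (Φ (pureState ψ) * ((B x)ᴴ * B x)).trace = p x) (r : Fin M → X) :
    outcomeProb (sequentialState Φ' (fun k => recordReset ψ B k)
      (attach (Matrix.single (fun _ => x₀) (fun _ => x₀) 1) (pureState ψ)) M)
      (attach (Matrix.single r r 1) 1) = iidLaw p M r := by
  simp only [sequentialState_recordReset B x₀ hlin hΦ hp, paddedRecord_self,
    outcomeProb_sum_attach_single hψ]

theorem isChannel_recordReset {ψ : EuclideanSpace ℂ (d × α)} (hψ : (pureState ψ).trace = 1)
    {B : X → Matrix (d × α) (d × α) ℂ} (hB : ∑ x, (B x)ᴴ * B x = 1) (k : ℕ) :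
    IsChannel (recordReset (M := M) ψ B k) := by
  refine .sum_jump ?_
  simp only [Fintype.sum_prod_type (α₁ := Fin M → X), Fintype.sum_prod_type (α₁ := X),
    recordResetKraus, attach_conjTranspose, attach_mul, Matrix.conjTranspose_single,
    Matrix.single_mul_single_same, star_one, mul_one, ← map_sum,
    sum_conjTranspose_mul_resetKraus hψ, hB, sum_attach]
  rw [Matrix.sum_single_one, attach_one_one]

end Simulation

section SequentialQFI

variable {d ι κ : Type*} [Fintype d] [DecidableEq d] [Fintype ι] [Fintype κ]
  {Ls : ι → Matrix d d ℂ} {Ln : κ → Matrix d d ℂ} {γ : κ → ℝ}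

theorem fisherInfo_le_sequentialQFI (Ls : ι → Matrix d d ℂ) (Ln : κ → Matrix d d ℂ) (γ : κ → ℝ)
    (T : ℝ) {α : Type} [Fintype α] [DecidableEq α] {ρ : Matrix (d × α) (d × α) ℂ}
    (hρ : IsDensityMatrix ρ) {C : ℕ → Matrix (d × α) (d × α) ℂ → Matrix (d × α) (d × α) ℂ}
    (hC : ∀ i, IsChannel (C i)) {X : Type*} [Fintype X] {E : X → Matrix (d × α) (d × α) ℂ}
    (hE : IsPOVM E) (θ : ℝ) (M : ℕ) :
    ENNReal.ofReal (fisherInfo (fun s x =>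
      outcomeProb (sequentialState (extendedEvolution α Ls Ln γ s (T / M)) C ρ M) (E x)) θ) ≤
      sequentialQFI Ls Ln γ T θ M := by
  let f := (Fintype.equivFin X).symm
  rw [← fisherInfo_comp_equiv _ f]
  refine le_iSup_of_le α <| le_iSup_of_le inferInstance <| le_iSup_of_le inferInstance <|
    le_iSup_of_le ρ <| le_iSup_of_le hρ <| le_iSup_of_le C <| le_iSup_of_le hC <| le_iSup_of_le _ <|
    le_iSup_of_le (fun i => E (f i)) <| le_iSup_of_le (hE.comp_equiv f) le_rfl

-- The outcomes of the rounds are written to a noiseless classical register in the ancilla, and each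
-- control operation consists of a measurement and a reset.
theorem measureResetQFI_le_sequentialQFI {α : Type} [Fintype α] [DecidableEq α]
    (h : IsPauliFamily (Sum.elim Ls Ln)) (hγ : ∀ k, 0 ≤ γ k) {T : ℝ} (hT : 0 ≤ T)
    {ψ : EuclideanSpace ℂ (d × α)} (hψ : IsDensityMatrix (pureState ψ)) (θ : ℝ) (M : ℕ) :
    measureResetQFI Ls Ln γ T ψ θ M ≤ sequentialQFI Ls Ln γ T θ M := by
  refine iSup_le fun m => iSup_le fun E => iSup_le fun hE => ?_
  choose B hB using fun x => exists_eq_conjTranspose_mul_self_of_posSemidef (hE.1 x)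
  obtain ⟨x₀, -, -⟩ := Finset.exists_ne_zero_of_sum_ne_zero
    ((sum_outcomeProb hψ hE).trans_ne one_ne_zero)
  have hB_sum : ∑ x, (B x)ᴴ * B x = 1 := by simp only [← hB, hE.2]
  have ht : 0 ≤ T / M := by positivity
  have hstate := fun s => ((IsFlipMixture.const hψ).extendedEvolution h hγ ht).posSemidef ht s
  have hprob : ∀ s x, (extendedEvolution α Ls Ln γ s (T / M) (pureState ψ) *
      ((B x)ᴴ * B x)).trace =
        outcomeProb (extendedEvolution α Ls Ln γ s (T / M) (pureState ψ)) (E x) := fun s x => by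
    rw [← hB, trace_mul_eq_outcomeProb (hstate s) (hE.1 x)]
  have hlaw := fun s => outcomeProb_sequentialState_recordReset (M := M) hψ.2 B x₀
    (Φ' := extendedEvolution (α × (Fin M → Fin m)) Ls Ln γ s (T / M)) (isLinearMap_evolve _ _)
    (extendedEvolution_attach Ls Ln γ s (T / M)) (hprob s)
  have hle := fisherInfo_le_sequentialQFI Ls Ln γ T
    (isDensityMatrix_attach_single hψ fun _ : Fin M => x₀) (isChannel_recordReset hψ.2 hB_sum)
    isPOVM_attach_single θ M
  simpa only [hlaw, measureResetFisherInfo] using hle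

end SequentialQFI

/-! ### Fast measure-and-reset -/

section ShortTime

theorem tendsto_mul_sq_div_of_hasDerivAt {q r : ℝ → ℝ} {a T : ℝ} (hq : HasDerivAt q a 0)
    (hq0 : q 0 = 0) (ha : a ≠ 0) (hr : ContinuousAt r 0) (hT : 0 < T) :
    Tendsto (fun M : ℕ => M * ((T / M * r (T / M)) ^ 2 / q (T / M))) atTop
      (𝓝 (T * r 0 ^ 2 / a)) := by
  have hstep : Tendsto (fun M : ℕ => T / (M : ℝ)) atTop (𝓝[>] 0) := by
    refine tendsto_nhdsWithin_iff.2 ⟨tendsto_const_div_atTop_nhds_zero_nat T, ?_⟩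
    filter_upwards [eventually_gt_atTop 0] with M hM
    exact div_pos hT (Nat.cast_pos.2 hM)
  have hslope : Tendsto (fun t => q t / t) (𝓝[>] 0) (𝓝 a) := by
    simpa [hq0, div_eq_inv_mul] using hq.tendsto_slope_zero_right
  have hlim : Tendsto (fun t => T * r t ^ 2 / (q t / t)) (𝓝[>] 0) (𝓝 (T * r 0 ^ 2 / a)) :=
    (((hr.tendsto.mono_left nhdsWithin_le_nhds).pow 2).const_mul T).div hslope ha
  refine (hlim.comp hstep).congr' ?_
  filter_upwards [eventually_gt_atTop 0] with M hM
  have hM' : (M : ℝ) ≠ 0 := by exact_mod_cast hM.ne'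
  simp only [Function.comp_apply, div_div_eq_mul_div]
  field_simp

variable {e ι κ : Type*} [Fintype e] [DecidableEq e] [Fintype ι] [Fintype κ]
  {Ls : ι → Matrix e e ℂ} {Ln : κ → Matrix e e ℂ} {ρ E : Matrix e e ℂ}

theorem hasDerivAt_outcomeProb_generator (h : IsPauliFamily (Sum.elim Ls Ln)) (γ : κ → ℝ)
    (ρ E : Matrix e e ℂ) (θ t : ℝ) :
    HasDerivAt (fun s => outcomeProb (evolve (generator Ls Ln γ s) t ρ) E)
      (t * (2 * θ * outcomeProb ((∑ j, dissipator (Ls j)) (evolve (generator Ls Ln γ θ) t ρ)) E))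
      θ := by
  simp only [h.evolve_generator, evolve_smul]
  have htime : HasDerivAt (fun s : ℝ => t * s ^ 2) (t * (2 * θ)) θ := by
    simpa using (hasDerivAt_pow 2 θ).const_mul t
  refine ((hasDerivAt_outcomeProb_evolve (∑ j, dissipator (Ls j))
    (evolve (∑ k, ((γ k : ℝ) : ℂ) • dissipator (Ln k)) t ρ) E (t * θ ^ 2)).comp θ
      htime).congr_deriv ?_
  ring

theorem outcomeProb_sum_dissipator (h : IsPauliFamily Ls) (h0 : outcomeProb ρ E = 0)
    (hS : ∀ j, outcomeProb (jump (Ls j) ρ) E = 1) :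
    outcomeProb ((∑ j, dissipator (Ls j)) ρ) E = Fintype.card ι := by
  simp [LinearMap.sum_apply, outcomeProb_sum, outcomeProb_dissipator (h.conjTranspose_mul_self _),
    h0, hS]

theorem outcomeProb_generator (h : IsPauliFamily (Sum.elim Ls Ln)) (γ : κ → ℝ)
    (h0 : outcomeProb ρ E = 0) (hS : ∀ j, outcomeProb (jump (Ls j) ρ) E = 1)
    (hN : ∀ k, outcomeProb (jump (Ln k) ρ) E = 0) (θ : ℝ) :
    outcomeProb (generator Ls Ln γ θ ρ) E = θ ^ 2 * Fintype.card ι := by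
  rw [generator, LinearMap.add_apply, outcomeProb_add, LinearMap.smul_apply, outcomeProb_smul,
    outcomeProb_sum_dissipator h.signal h0 hS]
  simp only [LinearMap.sum_apply, LinearMap.smul_apply, outcomeProb_sum, outcomeProb_smul,
    outcomeProb_dissipator (h.noise.conjTranspose_mul_self _), h0, hN, sub_zero, mul_zero,
    Finset.sum_const_zero, add_zero]

-- Both the probability of the outcome `E` and its derivative in `θ` are linear in the short time:
-- `p ≈ θ² K t` and `∂p ≈ 2 θ K t`, so that `(∂p)² / p ≈ 4 K t`.
theorem tendsto_mul_sq_deriv_div_outcomeProb [Nonempty ι] (h : IsPauliFamily (Sum.elim Ls Ln))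
    (γ : κ → ℝ) (h0 : outcomeProb ρ E = 0) (hS : ∀ j, outcomeProb (jump (Ls j) ρ) E = 1)
    (hN : ∀ k, outcomeProb (jump (Ln k) ρ) E = 0) {θ T : ℝ} (hθ : θ ≠ 0) (hT : 0 < T) :
    Tendsto (fun M : ℕ => M * (deriv (fun s =>
        outcomeProb (evolve (generator Ls Ln γ s) (T / M) ρ) E) θ ^ 2 /
        outcomeProb (evolve (generator Ls Ln γ θ) (T / M) ρ) E)) atTop
      (𝓝 (4 * Fintype.card ι * T)) := by
  have hK : (Fintype.card ι : ℝ) ≠ 0 := by exact_mod_cast Fintype.card_ne_zero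
  set G := generator Ls Ln γ θ with hG
  have hrate : HasDerivAt (fun t => outcomeProb (evolve G t ρ) E) (θ ^ 2 * Fintype.card ι) 0 := by
    simpa only [evolve_time_zero, hG, outcomeProb_generator h γ h0 hS hN] using
      hasDerivAt_outcomeProb_evolve G ρ E 0
  have hlim := tendsto_mul_sq_div_of_hasDerivAt hrate (by rw [evolve_time_zero, h0])
    (mul_ne_zero (pow_ne_zero 2 hθ) hK)
    ((hasDerivAt_outcomeProb_map_evolve G (∑ j, dissipator (Ls j)) ρ E 0).continuousAt.const_mul
      (2 * θ)) hT
  simp only [(hasDerivAt_outcomeProb_generator h γ ρ E θ _).deriv]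
  convert hlim using 2
  rw [evolve_time_zero, outcomeProb_sum_dissipator h.signal h0 hS]
  field_simp
  norm_num

end ShortTime

section MeasureReset

variable {d α ι κ : Type*} [Fintype d] [DecidableEq d] [Fintype α] [DecidableEq α] [Fintype ι]
  [Fintype κ] {Ls : ι → Matrix d d ℂ} {Ln : κ → Matrix d d ℂ} {γ : κ → ℝ} {T : ℝ}
  {ψ : EuclideanSpace ℂ (d × α)}

theorem tendsto_measureResetFisherInfo (h : IsPauliFamily (Sum.elim Ls Ln)) (hγ : ∀ k, 0 ≤ γ k)
    (hT : 0 < T) (hψ : IsDensityMatrix (pureState ψ)) {E : Bool → Matrix (d × α) (d × α) ℂ}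
    (hE : IsPOVM E) (h0 : outcomeProb (pureState ψ) (E false) = 0)
    (hS : ∀ j, outcomeProb (jump (withAncilla α (Ls j)) (pureState ψ)) (E false) = 1)
    (hN : ∀ k, outcomeProb (jump (withAncilla α (Ln k)) (pureState ψ)) (E false) = 0)
    {θ : ℝ} (hθ : θ ≠ 0) :
    Tendsto (measureResetFisherInfo Ls Ln γ T ψ E θ) atTop
      (𝓝 (ENNReal.ofReal (4 * Fintype.card ι * T))) := by
  have hup : ∀ᶠ M in atTop, measureResetFisherInfo Ls Ln γ T ψ E θ M ≤
      ENNReal.ofReal (4 * Fintype.card ι * T) :=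
    (eventually_ne_atTop 0).mono fun M hM => measureResetFisherInfo_le h hγ hT.le hψ hE hθ hM
  rcases isEmpty_or_nonempty ι with hι | hι
  · simp only [Fintype.card_eq_zero, Nat.cast_zero, mul_zero, zero_mul, ENNReal.ofReal_zero,
      nonpos_iff_eq_zero] at hup ⊢
    exact tendsto_const_nhds.congr' (hup.mono fun M hM => hM.symm)
  refine tendsto_of_tendsto_of_tendsto_of_le_of_le' (ENNReal.tendsto_ofReal
    (tendsto_mul_sq_deriv_div_outcomeProb (h.sumElim_withAncilla α) γ h0 hS hN hθ hT))
    tendsto_const_nhds (Eventually.of_forall fun M => ?_) hup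
  rw [measureResetFisherInfo_eq h hγ hT.le hψ hE]
  have ht : 0 ≤ T / M := by positivity
  have hlaw := ((IsFlipMixture.const hψ).extendedEvolution h hγ ht).isDifferentiableLaw hE ht θ
  refine ENNReal.ofReal_le_ofReal (mul_le_mul_of_nonneg_left ?_ M.cast_nonneg)
  rw [fisherInfo, Fintype.sum_bool]
  exact le_add_of_nonneg_left (div_nonneg (sq_nonneg _) (hlaw.nonneg θ true))

theorem measureResetFisherInfo_le_measureResetQFI (Ls : ι → Matrix d d ℂ) (Ln : κ → Matrix d d ℂ)
    (γ : κ → ℝ) (T : ℝ) (ψ : EuclideanSpace ℂ (d × α)) {X : Type*} [Fintype X]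
    {E : X → Matrix (d × α) (d × α) ℂ} (hE : IsPOVM E) (θ : ℝ) (M : ℕ) :
    measureResetFisherInfo Ls Ln γ T ψ E θ M ≤ measureResetQFI Ls Ln γ T ψ θ M := by
  let f := (Fintype.equivFin X).symm
  refine le_iSup_of_le _ (le_iSup_of_le (fun i => E (f i)) (le_iSup_of_le (hE.comp_equiv f)
    (ENNReal.ofReal_le_ofReal ?_)))
  exact (fisherInfo_comp_equiv (fun s => iidLaw (fun x => outcomeProb
    (extendedEvolution α Ls Ln γ s (T / M) (pureState ψ)) (E x)) M)
    (Equiv.arrowCongr (Equiv.refl (Fin M)) f) θ).ge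

end MeasureReset

/-! ### Pure states and the noisy subspace -/

section PureStates

variable {e : Type*} [Fintype e]

theorem isDensityMatrix_pureState {φ : EuclideanSpace ℂ e} (hφ : ‖φ‖ = 1) :
    IsDensityMatrix (pureState φ) := by
  refine ⟨Matrix.posSemidef_vecMulVec_self_star φ.ofLp, ?_⟩
  rw [pureState_eq_vecMulVec, Matrix.trace_vecMulVec, ← EuclideanSpace.inner_eq_star_dotProduct,
    inner_self_eq_norm_sq_to_K, hφ]
  simp

theorem posSemidef_of_isStarProjection {P : Matrix e e ℂ} (hP : IsStarProjection P) :
    P.PosSemidef := by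
  have h : Pᴴ * P = P := by
    rw [← Matrix.star_eq_conjTranspose, hP.isSelfAdjoint.star_eq, hP.isIdempotentElem.eq]
  exact h ▸ Matrix.posSemidef_conjTranspose_mul_self P

variable [DecidableEq e]

theorem applyOp_one (φ : EuclideanSpace ℂ e) : applyOp 1 φ = φ := by
  simp [applyOp]

theorem applyOp_sub (A B : Matrix e e ℂ) (φ : EuclideanSpace ℂ e) :
    applyOp (A - B) φ = applyOp A φ - applyOp B φ := by
  simp [applyOp]

theorem inner_applyOp_applyOp (A B : Matrix e e ℂ) (φ χ : EuclideanSpace ℂ e) :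
    ⟪applyOp A φ, applyOp B χ⟫_ℂ = ⟪φ, applyOp (Aᴴ * B) χ⟫_ℂ := by
  simp only [applyOp, Matrix.toLpLin_mul_same, Matrix.toEuclideanLin_conjTranspose_eq_adjoint,
    LinearMap.comp_apply, LinearMap.adjoint_inner_right]

theorem norm_applyOp {A : Matrix e e ℂ} (hA : Aᴴ * A = 1) (φ : EuclideanSpace ℂ e) :
    ‖applyOp A φ‖ = ‖φ‖ := by
  rw [@norm_eq_sqrt_re_inner ℂ, inner_applyOp_applyOp, hA, applyOp_one,
    ← @norm_eq_sqrt_re_inner ℂ]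

theorem jump_pureState (A : Matrix e e ℂ) (φ : EuclideanSpace ℂ e) :
    jump A (pureState φ) = pureState (applyOp A φ) := by
  rw [jump_apply, pureState_eq_vecMulVec, pureState_eq_vecMulVec, Matrix.vecMulVec_mul,
    Matrix.mul_vecMulVec, ← Matrix.star_mulVec]
  rfl

theorem trace_pureState_mul (φ : EuclideanSpace ℂ e) (A : Matrix e e ℂ) :
    (pureState φ * A).trace = ⟪φ, applyOp A φ⟫_ℂ := by
  rw [pureState_eq_vecMulVec, Matrix.trace_mul_comm, Matrix.mul_vecMulVec, Matrix.trace_vecMulVec]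
  rfl

theorem outcomeProb_pureState (φ : EuclideanSpace ℂ e) (A : Matrix e e ℂ) :
    outcomeProb (pureState φ) A = (⟪φ, applyOp A φ⟫_ℂ).re := by
  rw [outcomeProb, trace_pureState_mul]

theorem variance_le_one {A : Matrix e e ℂ} (hA : Aᴴ * A = 1) {φ : EuclideanSpace ℂ e}
    (hφ : ‖φ‖ = 1) : variance φ A ≤ 1 := by
  rw [variance, norm_applyOp hA, hφ, one_pow]
  exact sub_le_self _ (sq_nonneg _)

theorem variance_eq_one {A : Matrix e e ℂ} (hA : Aᴴ * A = 1) {φ : EuclideanSpace ℂ e}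
    (hφ : ‖φ‖ = 1) (h : ⟪φ, applyOp A φ⟫_ℂ = 0) : variance φ A = 1 := by
  rw [variance, norm_applyOp hA, hφ, h, norm_zero]
  norm_num

theorem isGreatest_sum_variance {d ι : Type*} [Fintype d] [DecidableEq d] [Fintype ι]
    {L : ι → Matrix d d ℂ} (hL : IsPauliFamily L) {c : ℝ} (hc : 0 ≤ c) {β : Type} [Fintype β]
    [DecidableEq β] {ψ : EuclideanSpace ℂ (d × β)} (hψ : ‖ψ‖ = 1)
    (h0 : ∀ j, ⟪ψ, applyOp (withAncilla β (L j)) ψ⟫_ℂ = 0) :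
    IsGreatest {x : ℝ | ∃ (α : Type) (_ : Fintype α) (_ : DecidableEq α)
      (φ : EuclideanSpace ℂ (d × α)), ‖φ‖ = 1 ∧ x = c * ∑ j, variance φ (withAncilla α (L j))}
      (c * Fintype.card ι) := by
  constructor
  · refine ⟨β, inferInstance, inferInstance, ψ, hψ, ?_⟩
    simp [variance_eq_one ((hL.withAncilla β).conjTranspose_mul_self _) hψ (h0 _)]
  · rintro x ⟨α, _, _, φ, hφ, rfl⟩
    refine mul_le_mul_of_nonneg_left ?_ hc
    simpa using Finset.sum_le_sum fun j (_ : j ∈ Finset.univ) =>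
      variance_le_one ((hL.withAncilla α).conjTranspose_mul_self j) hφ

end PureStates

section NoisySubspace

variable {e κ : Type*} [Fintype e] [DecidableEq e] {Ln : κ → Matrix e e ℂ}
  {ψ φ : EuclideanSpace ℂ e}

/-- The noisy subspace, spanned by the state `ψ` and its images under the noise operators; it is the
range of `noisyProjection Ln ψ`. -/
def noisySubspace (Ln : κ → Matrix e e ℂ) (ψ : EuclideanSpace ℂ e) :
    Submodule ℂ (EuclideanSpace ℂ e) :=
  Submodule.span ℂ (insert ψ (Set.range fun k => applyOp (Ln k) ψ))

theorem self_mem_noisySubspace : ψ ∈ noisySubspace Ln ψ :=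
  Submodule.subset_span (Set.mem_insert _ _)

theorem applyOp_mem_noisySubspace (k : κ) : applyOp (Ln k) ψ ∈ noisySubspace Ln ψ :=
  Submodule.subset_span (Set.mem_insert_of_mem _ ⟨k, rfl⟩)

theorem mem_orthogonal_noisySubspace :
    φ ∈ (noisySubspace Ln ψ)ᗮ ↔ ⟪ψ, φ⟫_ℂ = 0 ∧ ∀ k, ⟪applyOp (Ln k) ψ, φ⟫_ℂ = 0 := by
  rw [← Submodule.span_singleton_le_iff_mem, ← Submodule.IsOrtho, Submodule.isOrtho_comm,
    noisySubspace, Submodule.isOrtho_span]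
  simp

theorem applyOp_mem_orthogonal_noisySubspace {η : Type*} {A : η → Matrix e e ℂ}
    (hA : Pairwise fun P Q => ⟪applyOp (A P) ψ, applyOp (A Q) ψ⟫_ℂ = 0) {o : η} (ho : A o = 1)
    {P : η} (hP : o ≠ P) {f : κ → η} (hf : ∀ k, f k ≠ P) :
    applyOp (A P) ψ ∈ (noisySubspace (fun k => A (f k)) ψ)ᗮ :=
  mem_orthogonal_noisySubspace.2
    ⟨by simpa only [ho, applyOp_one] using hA hP, fun k => hA (hf k)⟩

theorem applyOp_noisyProjection (φ : EuclideanSpace ℂ e) :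
    applyOp (noisyProjection Ln ψ) φ = (noisySubspace Ln ψ).starProjection φ := by
  rw [applyOp, ← Matrix.coe_toEuclideanCLM_eq_toEuclideanLin, noisyProjection]
  simp [noisySubspace]

theorem isStarProjection_noisyProjection : IsStarProjection (noisyProjection Ln ψ) :=
  (isStarProjection_starProjection (U := noisySubspace Ln ψ)).map
    (Matrix.toEuclideanCLM (n := e) (𝕜 := ℂ)).symm.toStarAlgHom

theorem isPOVM_noisyMeasurement : IsPOVM (noisyMeasurement Ln ψ) := by
  refine ⟨fun
    | true => posSemidef_of_isStarProjection isStarProjection_noisyProjection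
    | false => posSemidef_of_isStarProjection isStarProjection_noisyProjection.one_sub, ?_⟩
  rw [Fintype.sum_bool]
  exact add_sub_cancel _ _

theorem outcomeProb_noisyMeasurement_false (φ : EuclideanSpace ℂ e) :
    outcomeProb (pureState φ) (noisyMeasurement Ln ψ false) =
      (⟪φ, φ - (noisySubspace Ln ψ).starProjection φ⟫_ℂ).re := by
  rw [outcomeProb_pureState, noisyMeasurement, applyOp_sub, applyOp_one, applyOp_noisyProjection]

theorem outcomeProb_noisyMeasurement_of_mem (h : φ ∈ noisySubspace Ln ψ) :
    outcomeProb (pureState φ) (noisyMeasurement Ln ψ false) = 0 := by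
  rw [outcomeProb_noisyMeasurement_false, Submodule.starProjection_eq_self_iff.2 h, sub_self,
    inner_zero_right, Complex.zero_re]

theorem outcomeProb_noisyMeasurement_of_mem_orthogonal (hφ : ‖φ‖ = 1)
    (h : φ ∈ (noisySubspace Ln ψ)ᗮ) :
    outcomeProb (pureState φ) (noisyMeasurement Ln ψ false) = 1 := by
  rw [outcomeProb_noisyMeasurement_false, (Submodule.starProjection_apply_eq_zero_iff _).2 h,
    sub_zero, inner_self_eq_norm_sq_to_K, hφ]
  simp

end NoisySubspace

/-! ### Signals outside the noisy subspace -/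

theorem HasFastControlVanishingSignalLimit.of_forall {F : ℝ → ℕ → ℝ≥0∞} {v : ℝ}
    (h : ∀ θ ≠ 0, Tendsto (F θ) atTop (𝓝 (ENNReal.ofReal v))) :
    HasFastControlVanishingSignalLimit F v :=
  ⟨fun _ => ENNReal.ofReal v,
    eventually_mem_nhdsWithin.mono fun θ (hθ : 0 < θ) => h θ hθ.ne', tendsto_const_nhds⟩

section Limits

variable {d α ι κ : Type*} [Fintype d] [DecidableEq d] [Fintype α] [DecidableEq α]
  {Ls : ι → Matrix d d ℂ} {Ln : κ → Matrix d d ℂ} {ψ : EuclideanSpace ℂ (d × α)}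

theorem outcomeProb_applyOp_signal (h : IsPauliFamily Ls) (hψ : ‖ψ‖ = 1) {j : ι}
    (hj : applyOp (withAncilla α (Ls j)) ψ ∈ (noisySubspace (fun k => withAncilla α (Ln k)) ψ)ᗮ) :
    outcomeProb (pureState (applyOp (withAncilla α (Ls j)) ψ))
      (noisyMeasurement (fun k => withAncilla α (Ln k)) ψ false) = 1 :=
  outcomeProb_noisyMeasurement_of_mem_orthogonal
    ((norm_applyOp ((h.withAncilla α).conjTranspose_mul_self j) ψ).trans hψ) hj

variable [Fintype ι] [Fintype κ] {γ : κ → ℝ} {T : ℝ}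

theorem tendsto_measureResetFisherInfo_noisyMeasurement (h : IsPauliFamily (Sum.elim Ls Ln))
    (hγ : ∀ k, 0 ≤ γ k) (hT : 0 < T) (hψ : ‖ψ‖ = 1)
    (hS : ∀ j, applyOp (withAncilla α (Ls j)) ψ ∈
      (noisySubspace (fun k => withAncilla α (Ln k)) ψ)ᗮ) {θ : ℝ} (hθ : θ ≠ 0) :
    Tendsto (measureResetFisherInfo Ls Ln γ T ψ
        (noisyMeasurement (fun k => withAncilla α (Ln k)) ψ) θ) atTop
      (𝓝 (ENNReal.ofReal (4 * Fintype.card ι * T))) := by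
  refine tendsto_measureResetFisherInfo h hγ hT (isDensityMatrix_pureState hψ)
    isPOVM_noisyMeasurement (outcomeProb_noisyMeasurement_of_mem self_mem_noisySubspace)
    (fun j => ?_) (fun k => ?_) hθ
  · rw [jump_pureState]
    exact outcomeProb_applyOp_signal h.signal hψ (hS j)
  · rw [jump_pureState]
    exact outcomeProb_noisyMeasurement_of_mem (applyOp_mem_noisySubspace k)

theorem tendsto_measureResetQFI (h : IsPauliFamily (Sum.elim Ls Ln)) (hγ : ∀ k, 0 ≤ γ k)
    (hT : 0 < T) (hψ : ‖ψ‖ = 1)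
    (hS : ∀ j, applyOp (withAncilla α (Ls j)) ψ ∈
      (noisySubspace (fun k => withAncilla α (Ln k)) ψ)ᗮ) {θ : ℝ} (hθ : θ ≠ 0) :
    Tendsto (measureResetQFI Ls Ln γ T ψ θ) atTop
      (𝓝 (ENNReal.ofReal (4 * Fintype.card ι * T))) := by
  refine tendsto_of_tendsto_of_tendsto_of_le_of_le'
    (tendsto_measureResetFisherInfo_noisyMeasurement h hγ hT hψ hS hθ) tendsto_const_nhds
    (Eventually.of_forall fun M =>
      measureResetFisherInfo_le_measureResetQFI Ls Ln γ T ψ isPOVM_noisyMeasurement θ M) ?_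
  filter_upwards [eventually_ne_atTop 0] with M hM
  exact measureResetQFI_le h hγ hT.le (isDensityMatrix_pureState hψ) hθ hM

theorem tendsto_sequentialQFI {β : Type} [Fintype β] [DecidableEq β]
    {ψ : EuclideanSpace ℂ (d × β)} (h : IsPauliFamily (Sum.elim Ls Ln)) (hγ : ∀ k, 0 ≤ γ k)
    (hT : 0 < T) (hψ : ‖ψ‖ = 1)
    (hS : ∀ j, applyOp (withAncilla β (Ls j)) ψ ∈
      (noisySubspace (fun k => withAncilla β (Ln k)) ψ)ᗮ) {θ : ℝ} (hθ : θ ≠ 0) :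
    Tendsto (sequentialQFI Ls Ln γ T θ) atTop (𝓝 (ENNReal.ofReal (4 * Fintype.card ι * T))) := by
  refine tendsto_of_tendsto_of_tendsto_of_le_of_le' (tendsto_measureResetQFI h hγ hT hψ hS hθ)
    tendsto_const_nhds (Eventually.of_forall fun M =>
      measureResetQFI_le_sequentialQFI h hγ hT.le (isDensityMatrix_pureState hψ) θ M) ?_
  filter_upwards [eventually_ne_atTop 0] with M hM
  exact sequentialQFI_le h hγ hT.le hθ hM

theorem tendsto_sequentialQFI_of_isEmpty [IsEmpty κ] {β : Type} [Fintype β] [DecidableEq β]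
    {ψ : EuclideanSpace ℂ (d × β)} (h : IsPauliFamily Ls) (hT : 0 < T) (hψ : ‖ψ‖ = 1)
    (h0 : ∀ j, ⟪ψ, applyOp (withAncilla β (Ls j)) ψ⟫_ℂ = 0) {θ : ℝ} (hθ : θ ≠ 0) :
    Tendsto (sequentialQFI Ls Ln γ T θ) atTop (𝓝 (ENNReal.ofReal (4 * Fintype.card ι * T))) := by
  have hfam : IsPauliFamily (Sum.elim Ls Ln) := by
    convert h.comp (Equiv.sumEmpty ι κ) using 1
    exact funext (Sum.rec (fun _ => rfl) isEmptyElim)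
  exact tendsto_sequentialQFI hfam isEmptyElim hT hψ
    (fun j => mem_orthogonal_noisySubspace.2 ⟨h0 j, isEmptyElim⟩) hθ

end Limits

/-! ### Bell states -/

section Bell

variable {d : Type*} [Fintype d] (b : OrthonormalBasis d ℂ (EuclideanSpace ℂ d))

/-- The matrix of coefficients of the unnormalised Bell state of `b`, which turns the operators
`A ⊗ I` on the Bell state into left multiplications by `A`. -/
noncomputable def bellMatrix : Matrix d d ℂ :=
  Matrix.of fun x y => ∑ j, b j x * b j y

variable [DecidableEq d]

theorem bellMatrix_mul_conjTranspose : bellMatrix b * (bellMatrix b)ᴴ = 1 := by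
  let U : Matrix d d ℂ := Matrix.of fun x j => b j x
  have hU : U * Uᴴ = 1 := by
    ext x y
    have h := b.sum_inner_mul_inner (EuclideanSpace.single x 1) (EuclideanSpace.single y 1)
    simp only [EuclideanSpace.inner_single_left, EuclideanSpace.inner_single_right] at h
    simpa [U, Matrix.mul_apply, Matrix.one_apply, Pi.single_apply, eq_comm] using h
  have hU' : Uᴴ * U = 1 := mul_eq_one_comm.1 hU
  have hB : bellMatrix b = U * Uᵀ := by
    ext x y
    simp [bellMatrix, U, Matrix.mul_apply]
  have hT : Uᵀ * (Uᵀ)ᴴ = 1 := by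
    have h := congrArg Matrix.transpose hU'
    rwa [Matrix.transpose_mul, Matrix.transpose_one] at h
  rw [hB, Matrix.conjTranspose_mul, Matrix.mul_assoc, ← Matrix.mul_assoc Uᵀ, hT, one_mul, hU]

theorem applyOp_bellState_apply (A : Matrix d d ℂ) (x : d × d) :
    applyOp (withAncilla d A) (bellState b) x =
      (1 / (Real.sqrt (Fintype.card d) : ℂ)) * (A * bellMatrix b) x.1 x.2 := by
  change ∑ z, _ = _
  rw [Fintype.sum_prod_type, Matrix.mul_apply, Finset.mul_sum]
  refine Finset.sum_congr rfl fun y _ => ?_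
  rw [Finset.sum_eq_single x.2]
  · simp [withAncilla, bellState, bellMatrix]
    ring
  · intro z _ hz
    simp [withAncilla, hz.symm]
  · simp

theorem inner_applyOp_bellState (A B : Matrix d d ℂ) :
    ⟪applyOp (withAncilla d A) (bellState b), applyOp (withAncilla d B) (bellState b)⟫_ℂ =
      (Fintype.card d : ℂ)⁻¹ * (Aᴴ * B).trace := by
  have hs : ((Real.sqrt (Fintype.card d) : ℝ) : ℂ)⁻¹ * ((Real.sqrt (Fintype.card d) : ℝ) : ℂ)⁻¹ =
      (Fintype.card d : ℂ)⁻¹ := by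
    rw [← mul_inv, ← Complex.ofReal_mul, Real.mul_self_sqrt (Nat.cast_nonneg _),
      Complex.ofReal_natCast]
  have htr : (Aᴴ * B).trace = ((A * bellMatrix b)ᴴ * (B * bellMatrix b)).trace := by
    rw [Matrix.conjTranspose_mul, Matrix.mul_assoc, Matrix.trace_mul_comm (bellMatrix b)ᴴ,
      Matrix.mul_assoc, Matrix.mul_assoc, bellMatrix_mul_conjTranspose, mul_one]
  rw [htr, ← hs, PiLp.inner_apply, Fintype.sum_prod_type, Matrix.trace, Finset.mul_sum,
    Finset.sum_comm]
  refine Finset.sum_congr rfl fun y _ => ?_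
  rw [Matrix.diag_apply, Matrix.mul_apply, Finset.mul_sum]
  refine Finset.sum_congr rfl fun x _ => ?_
  rw [RCLike.inner_apply, applyOp_bellState_apply, applyOp_bellState_apply,
    Matrix.conjTranspose_apply, starRingEnd_apply, star_mul']
  simp
  ring

theorem orthonormal_applyOp_bellState [Nonempty d] {η : Type*} {L : η → Matrix d d ℂ}
    (hL : IsPauliFamily L) (htr : Pairwise fun P Q => (L P * L Q).trace = 0) :
    Orthonormal ℂ fun P => applyOp (withAncilla d (L P)) (bellState b) := by
  classical
  rw [orthonormal_iff_ite]
  intro P Q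
  rw [inner_applyOp_bellState, hL.conjTranspose_eq]
  split_ifs with h
  · subst h
    simp [hL.mul_self]
  · rw [htr h, mul_zero]

end Bell

/-! ### Pauli strings -/

section PauliStrings

variable {n : ℕ}

/-- The tensor product of one-qubit operators, in the computational basis `Fin n → Fin 2`;
`pauliString P` is the case of the one-qubit Pauli operators `pauli (P i)`. -/
def qubitTensor (A : Fin n → Matrix (Fin 2) (Fin 2) ℂ) : Matrix (Fin n → Fin 2) (Fin n → Fin 2) ℂ :=
  Matrix.of fun x y => ∏ i, A i (x i) (y i)

theorem qubitTensor_mul (A B : Fin n → Matrix (Fin 2) (Fin 2) ℂ) :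
    qubitTensor A * qubitTensor B = qubitTensor fun i => A i * B i := by
  ext x z
  simp only [qubitTensor, Matrix.mul_apply, Matrix.of_apply, Finset.prod_univ_sum,
    Fintype.piFinset_univ, Finset.prod_mul_distrib]

theorem qubitTensor_one : qubitTensor (fun _ : Fin n => 1) = 1 := by
  ext x y
  simp only [qubitTensor, Matrix.of_apply, Matrix.one_apply, Finset.prod_ite_zero,
    Finset.prod_const_one, Finset.mem_univ, true_imp_iff, funext_iff]

theorem qubitTensor_conjTranspose (A : Fin n → Matrix (Fin 2) (Fin 2) ℂ) :
    (qubitTensor A)ᴴ = qubitTensor fun i => (A i)ᴴ := by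
  ext x y
  simp [qubitTensor]

theorem qubitTensor_smul (c : Fin n → ℂ) (A : Fin n → Matrix (Fin 2) (Fin 2) ℂ) :
    qubitTensor (fun i => c i • A i) = (∏ i, c i) • qubitTensor A := by
  ext x y
  simp [qubitTensor, Finset.prod_mul_distrib]

theorem trace_qubitTensor (A : Fin n → Matrix (Fin 2) (Fin 2) ℂ) :
    (qubitTensor A).trace = ∏ i, (A i).trace := by
  simp only [Matrix.trace, Matrix.diag_apply, Finset.prod_univ_sum, Fintype.piFinset_univ]
  rfl

theorem pauli_conjTranspose (a : Fin 4) : (pauli a)ᴴ = pauli a := by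
  fin_cases a <;> ext i j <;> fin_cases i <;> fin_cases j <;> simp [pauli]

theorem pauli_mul_self (a : Fin 4) : pauli a * pauli a = 1 := by
  fin_cases a <;> ext i j <;> fin_cases i <;> fin_cases j <;> simp [pauli, Matrix.mul_apply]

theorem exists_pauli_mul_comm (a b : Fin 4) :
    ∃ c : ℂ, (c = 1 ∨ c = -1) ∧ pauli a * pauli b = c • (pauli b * pauli a) := by
  have h : pauli a * pauli b = pauli b * pauli a ∨ pauli a * pauli b = -(pauli b * pauli a) := by
    fin_cases a <;> fin_cases b <;> simp [pauli]
  rcases h with h | h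
  · exact ⟨1, Or.inl rfl, by rw [h, one_smul]⟩
  · exact ⟨-1, Or.inr rfl, by rw [h, neg_one_smul]⟩

theorem trace_pauli_mul_of_ne {a b : Fin 4} (h : a ≠ b) : (pauli a * pauli b).trace = 0 := by
  fin_cases a <;> fin_cases b <;> simp_all [pauli, Matrix.trace, Fin.sum_univ_two]

theorem pauliString_eq_qubitTensor (P : Fin n → Fin 4) :
    pauliString P = qubitTensor fun i => pauli (P i) := rfl

theorem isPauliFamily_pauliString : IsPauliFamily (pauliString (n := n)) where
  conjTranspose_eq P := by
    simp only [pauliString_eq_qubitTensor, qubitTensor_conjTranspose, pauli_conjTranspose]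
  mul_self P := by
    simp only [pauliString_eq_qubitTensor, qubitTensor_mul, pauli_mul_self, qubitTensor_one]
  comm P Q := by
    choose c hc hPQ using fun i => exists_pauli_mul_comm (P i) (Q i)
    have hprod : ∏ i, c i = 1 ∨ ∏ i, c i = -1 := by
      refine Finset.prod_induction c (fun z => z = 1 ∨ z = -1) ?_ (Or.inl rfl) fun i _ => hc i
      rintro _ _ (rfl | rfl) (rfl | rfl) <;> simp
    simp only [pauliString_eq_qubitTensor, qubitTensor_mul, hPQ, qubitTensor_smul]
    exact hprod.imp (fun h => by rw [h, one_smul]) fun h => by rw [h, neg_one_smul]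

theorem pauliString_zero : pauliString (0 : Fin n → Fin 4) = 1 :=
  qubitTensor_one

theorem pairwise_trace_pauliString_mul :
    Pairwise fun P Q : Fin n → Fin 4 => (pauliString P * pauliString Q).trace = 0 := by
  intro P Q hPQ
  obtain ⟨i, hi⟩ := Function.ne_iff.1 hPQ
  rw [pauliString_eq_qubitTensor, pauliString_eq_qubitTensor, qubitTensor_mul, trace_qubitTensor]
  exact Finset.prod_eq_zero (Finset.mem_univ i) (trace_pauli_mul_of_ne hi)

end PauliStrings

theorem mainTheorem4_general {d : Type} [Fintype d] [DecidableEq d] [Nonempty d] {η : Type*}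
    {L : η → Matrix d d ℂ} (hL : IsPauliFamily L)
    (htr : Pairwise fun P Q => (L P * L Q).trace = 0) {o : η} (ho : L o = 1) (S N : Finset η)
    (hS : o ∉ S) (hSN : Disjoint S N) (γ : N → ℝ) (hγ : ∀ k, 0 ≤ γ k) (T : ℝ) (hT : 0 < T)
    (b : OrthonormalBasis d ℂ (EuclideanSpace ℂ d)) :
    let Ls : S → Matrix d d ℂ := fun P => L P.1
    let Ln : N → Matrix d d ℂ := fun P => L P.1
    let ψ : EuclideanSpace ℂ (d × d) := bellState b
    let L' := fun P : η => withAncilla d (L P)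
    let E := noisyMeasurement (fun k : N => L' k.1) ψ
    let v : ℝ := 4 * S.card * T
    HasFastControlVanishingSignalLimit
      (sequentialQFI Ls (Fin.elim0 : Fin 0 → Matrix _ _ ℂ) Fin.elim0 T) v ∧
    IsGreatest {x : ℝ | ∃ (α : Type) (_ : Fintype α) (_ : DecidableEq α)
      (φ : EuclideanSpace ℂ (d × α)), ‖φ‖ = 1 ∧
        x = 4 * T * ∑ j, variance φ (withAncilla α (Ls j))} v ∧
    HasFastControlVanishingSignalLimit (measureResetQFI Ls Ln γ T ψ) v ∧
    IsPOVM E ∧ HasFastControlVanishingSignalLimit (measureResetFisherInfo Ls Ln γ T ψ E) v ∧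
    4 * T * ∑ j : S, outcomeProb (pureState (applyOp (L' j.1) ψ)) (E false) = v ∧
    Orthonormal ℂ (fun P => applyOp (L' P) ψ) := by
  intro Ls Ln ψ L' E v
  have horth : Orthonormal ℂ fun P => applyOp (L' P) ψ := orthonormal_applyOp_bellState b hL htr
  have hone : L' o = 1 := by simp only [L', ho, withAncilla, Matrix.one_kronecker_one]
  have hψ : ‖ψ‖ = 1 := by simpa only [hone, applyOp_one] using horth.1 o
  have hsignal : ∀ j : S, applyOp (L' j) ψ ∈ (noisySubspace (fun k : N => L' k) ψ)ᗮ := fun j =>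
    applyOp_mem_orthogonal_noisySubspace horth.2 hone (ne_of_mem_of_not_mem j.2 hS).symm
      fun k => Finset.disjoint_iff_ne.1 hSN.symm k k.2 j j.2
  have hmean := fun j => (mem_orthogonal_noisySubspace.1 (hsignal j)).1
  have hfam := hL.sumElim (fun P : S => P.1) fun P : N => P.1
  have hv : v = 4 * Fintype.card S * T := by rw [Fintype.card_coe]
  have hv' : v = 4 * T * Fintype.card S := by rw [hv, mul_right_comm]
  refine ⟨?_, ?_, ?_, isPOVM_noisyMeasurement, ?_, ?_, horth⟩
  · exact hv ▸ .of_forall fun θ => tendsto_sequentialQFI_of_isEmpty hfam.signal hT hψ hmean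
  · exact hv' ▸ isGreatest_sum_variance hfam.signal (by positivity) hψ hmean
  · exact hv ▸ .of_forall fun θ => tendsto_measureResetQFI hfam hγ hT hψ hsignal
  · exact hv ▸ .of_forall fun θ =>
      tendsto_measureResetFisherInfo_noisyMeasurement hfam hγ hT hψ hsignal
  · simp [hv', E, L', outcomeProb_applyOp_signal hfam.signal hψ (hsignal _)]

theorem mainTheorem4 (n : ℕ) (S N : Finset (Fin n → Fin 4))
    (hS : (0 : Fin n → Fin 4) ∉ S) (hN : (0 : Fin n → Fin 4) ∉ N) (hSN : Disjoint S N)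
    (γ : N → ℝ) (hγ : ∀ k, 0 < γ k) (T : ℝ) (hT : 0 < T)
    (b : OrthonormalBasis (Fin n → Fin 2) ℂ (EuclideanSpace ℂ (Fin n → Fin 2))) :
    let Ls : S → Matrix (Fin n → Fin 2) (Fin n → Fin 2) ℂ := fun P => pauliString P.1
    let Ln : N → Matrix (Fin n → Fin 2) (Fin n → Fin 2) ℂ := fun P => pauliString P.1
    let ψ : EuclideanSpace ℂ ((Fin n → Fin 2) × (Fin n → Fin 2)) := bellState b
    let L' := fun P : Fin n → Fin 4 => withAncilla (Fin n → Fin 2) (pauliString P)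
    let E := noisyMeasurement (fun k : N => L' k.1) ψ
    let v : ℝ := 4 * S.card * T
    -- the optimal noiseless QFI with fast and precise control is `4 K T`
    HasFastControlVanishingSignalLimit
      (sequentialQFI Ls (Fin.elim0 : Fin 0 → Matrix _ _ ℂ) Fin.elim0 T) v ∧
    -- and it is the maximum of `4 T` times the sum of the variances of the signal operators
    IsGreatest {x : ℝ | ∃ (α : Type) (_ : Fintype α) (_ : DecidableEq α)
      (φ : EuclideanSpace ℂ ((Fin n → Fin 2) × α)), ‖φ‖ = 1 ∧
        x = 4 * T * ∑ j, variance φ (withAncilla α (Ls j))} v ∧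
    -- the noisy measure-and-reset strategy with a Bell state recovers it
    HasFastControlVanishingSignalLimit (measureResetQFI Ls Ln γ T ψ) v ∧
    -- already when only the projection onto the noisy subspace is measured
    IsPOVM E ∧ HasFastControlVanishingSignalLimit (measureResetFisherInfo Ls Ln γ T ψ E) v ∧
    4 * T * ∑ j : S, outcomeProb (pureState (applyOp (L' j.1) ψ)) (E false) = v ∧
    -- the Bell state (`P = 0`) and its Pauli images are pairwise orthogonal unit vectors
    Orthonormal ℂ (fun P => applyOp (L' P) ψ) :=
  mainTheorem4_general isPauliFamily_pauliString pairwise_trace_pauliString_mul pauliString_zero S N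
    hS hSN γ (fun k => (hγ k).le) T hT b
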